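/- Let $n\ge 1$, let $S^{n-1}$ be the Euclidean unit sphere of $\mathbb R^n$, let $\xi^\perp$ be the hyperplane through the origin orthogonal to $\xi$, let $|\cdot|$ denote volume of the proper dimension, and let $c_n=|B_2^n|^{(n-1)/n}/|B_2^{n-1}|$, where $B_2^k$ is the closed Euclidean unit ball of $\mathbb R^k$. A closed bounded set $K\subset\mathbb R^n$ is a star body if the origin is an interior point of $K$, every line through the origin meets the boundary of $K$ at exactly two points different from the origin, and the Minkowski functional $\|x\|_K=\min\{a\ge 0: x\in aK\}$ is continuous on $\mathbb R^n$; its radial function is $\rho_K(x)=\|x\|_K^{-1}$, $x\neq 0$. For origin-symmetric star bodies $K,L$, $K$ is the intersection body of $L$ if $\rho_K(\xi)=|L\cap\xi^\perp|$ for all $\xi\in S^{n-1}$. An origin-symmetric star body is called an intersection body if it belongs to the closure of the class of intersection bodies of star bodies in the radial metric $\rho(K,L)=\max_{\xi\in S^{n-1}}|\rho_K(\xi)-\rho_L(\xi)|$. If $K$ and $L$ are intersection bodies in $\mathbb R^n$, then $$\left||K|^{\frac{n-1}n}-|L|^{\frac{n-1}n}\right|\le c_n\max_{\xi\in S^{n-1}}\Big||K\cap\xi^\perp|-|L\cap\xi^\perp|\Big|,$$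 and every intersection body $K$ in $\mathbb R^n$ satisfies the hyperplane inequality $$|K|^{\frac{n-1}n}\le c_n\max_{\xi\in S^{n-1}}|K\cap\xi^\perp|.$$ In particular, both inequalities hold for all origin-symmetric convex bodies (compact convex sets with nonempty interior that are symmetric about the origin) when $n=3$ or $n=4$, since every such body is an intersection body. -/

import Mathlib

open MeasureTheory Metric Set
open scoped Pointwise

namespace SectionStability

/-- `ℝⁿ` with its Euclidean norm, inner product and Lebesgue measure. -/
abbrev E (n : ℕ) : Type := EuclideanSpace ℝ (Fin n)

/-- The unit sphere `S^{n-1}` of `ℝⁿ`. -/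
abbrev unitSphere (n : ℕ) : Set (E n) := sphere (0 : E n) 1

/-- `K` is origin-symmetric: `-K = K`. -/
def IsOriginSymmetric {n : ℕ} (K : Set (E n)) : Prop := -K = K

/-- The volume `|K|` of a set in `ℝⁿ`. -/
noncomputable def vol {n : ℕ} (K : Set (E n)) : ℝ := (volume : Measure (E n)).real K

/-- The central hyperplane `ξ^⊥`, a Euclidean space of dimension `n - 1` when `ξ ≠ 0`. -/
noncomputable abbrev perp {n : ℕ} (ξ : E n) : Submodule ℝ (E n) := (Submodule.span ℝ {ξ})ᗮ

/-- The hyperplane section function `|K ∩ ξ^⊥|`: the Lebesgue measure of the Euclidean space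
`ξ^⊥`, evaluated at the part of `K` that lies in `ξ^⊥`. -/
noncomputable def sectionVol {n : ℕ} (K : Set (E n)) (ξ : E n) : ℝ :=
  (volume : Measure (perp ξ)).real {x : perp ξ | (x : E n) ∈ K}

/-- A star body: a closed bounded set with the origin in its interior, such that every line through
the origin crosses the boundary at exactly two points different from the origin, and such that the
Minkowski functional is continuous. (As `0 ∈ K`, Mathlib's `gauge K x`, the infimum of all `a > 0`
with `x ∈ a • K`, is the Minkowski functional.) -/
structure IsStarBody {n : ℕ} (K : Set (E n)) : Prop where
  isClosed : IsClosed K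
  isBounded : Bornology.IsBounded K
  zero_mem_interior : (0 : E n) ∈ interior K
  line_boundary : ∀ u : E n, u ≠ 0 →
    {x : E n | x ∈ Submodule.span ℝ {u} ∧ x ∈ frontier K ∧ x ≠ 0}.ncard = 2
  continuous_gauge : Continuous (gauge K)

/-- The radial function `ρ_K(x) = ‖x‖_K⁻¹`, used at `x ≠ 0`. -/
noncomputable def radial {n : ℕ} (K : Set (E n)) (x : E n) : ℝ := (gauge K x)⁻¹

/-- `K` is the intersection body of `L`, where both are origin-symmetric star bodies:
`ρ_K(ξ) = |L ∩ ξ^⊥|` for every unit vector `ξ`. -/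
structure IsIntersectionBodyOf {n : ℕ} (K L : Set (E n)) : Prop where
  isStarBody_left : IsStarBody K
  symmetric_left : IsOriginSymmetric K
  isStarBody_right : IsStarBody L
  symmetric_right : IsOriginSymmetric L
  radial_eq : ∀ ξ ∈ unitSphere n, radial K ξ = sectionVol L ξ

/-- Intersection bodies: the closure, among the origin-symmetric star bodies, of the class of
intersection bodies of star bodies in the radial metric `max_ξ |ρ_K(ξ) - ρ_{K'}(ξ)|`. -/
structure IsIntersectionBody {n : ℕ} (K : Set (E n)) : Prop where
  isStarBody : IsStarBody K
  symmetric : IsOriginSymmetric K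
  mem_closure : ∀ ε : ℝ, 0 < ε → ∃ K' L' : Set (E n), IsIntersectionBodyOf K' L' ∧
    ∀ ξ ∈ unitSphere n, |radial K ξ - radial K' ξ| ≤ ε

/-- An origin-symmetric convex body: a compact convex set with nonempty interior and `-K = K`. -/
structure IsSymmetricConvexBody {n : ℕ} (K : Set (E n)) : Prop where
  convex : Convex ℝ K
  isCompact : IsCompact K
  nonempty_interior : (interior K).Nonempty
  symmetric : IsOriginSymmetric K

/-- The constant `c_n = |B_2^n|^{(n-1)/n} / |B_2^{n-1}|`, used for `n ≥ 1`. -/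
noncomputable def sectionConst (n : ℕ) : ℝ :=
  vol (closedBall (0 : E n) 1) ^ (((n : ℝ) - 1) / n) / vol (closedBall (0 : E (n - 1)) 1)

end SectionStability

/-!
# Stability in the hyperplane inequality for intersection bodies

**The two inequalities.** For `2 ≤ n`, integrating the section function of one star body against
`ρ^{n-1}` of another over the sphere is symmetric in the two bodies
(`integral_pow_mul_sectionVol_comm`): both integrals are the limit, up to the same factor, of the
measure of the pairs `(x, y)` of points of the two bodies with `|⟨x, y⟩| ≤ ε`, divided by `2 ε`.
Let `|K ∩ ξ^⊥| ≤ |L ∩ ξ^⊥| + T` for all `ξ`. Integrating this against `ρ_M^{n-1}` and passing to the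
intersection body `I` of `M` gives
`∫ ρ_K^{n-1} ρ_I ≤ ∫ ρ_L^{n-1} ρ_I + T / κ_{n-1} ∫ ρ_I`, where `κ_{n-1}` is the volume of the unit
ball of dimension `n - 1`, and the last term comes from duality with the Euclidean ball
(`IsIntersectionBodyOf.integral_le`). The inequality passes to limits in the radial metric, so
`ρ_I` may be replaced by `ρ_K` when `K` is an intersection body. Then the left side is `n |K|`, and
Hölder's inequality on the right and division by `(n |K|)^{1/n}` give
`|K|^{(n-1)/n} ≤ |L|^{(n-1)/n} + c_n T` (`IsIntersectionBody.vol_rpow_le`), for any star body `L`.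
Exchanging the roles of `K` and `L` gives the difference inequality, and small balls `L` give the
hyperplane inequality. In dimension one everything is trivial.

**Convex bodies in dimensions three and four.** The spherical Radon transform of a positive even
density `G` is, up to a constant, the radial function of the intersection body of the star body with
`ρ^{n-1} = G` (`exists_isIntersectionBodyOf`). So it is enough to approximate `ρ_K` uniformly by
Radon transforms of positive even densities. With `A(t) = |K ∩ (ξ^⊥ + t ξ)|` and
`b(t) = (c² + t²)^{-(n-1)/2}` the densities are `∫ (A(t/2) - A(t)) b(t) dt` (`density`), to which a
small positive constant is added.

They are nonnegative, since the Prékopa–Leindler inequality and the symmetry of `K` give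
`A(t) ≤ A(t/2)` (`volume_slice_le_volume_slice_half`). By Fubini's theorem and the formula for the
volume of an ellipsoid, their Radon transform at `θ` is the integral over `y ∈ θ^⊥` of the length of
the chord of `K` through `y` in direction `θ` against a radial kernel (`integral_density`), which
is of order `c² |y|^{-3}` for `|y|` large compared with `c`. As `|y|^{-3}` is not integrable at the
origin in dimension `n - 1 ≤ 3`, the normalized kernel concentrates at `y = 0` when `c → 0`
(`exists_kernelMass_le`), and the transform tends to the length `2 ρ_K(θ)` of the central chord,
uniformly in `θ`.
-/

set_option linter.unusedSectionVars false

namespace SectionStability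
open Filter Topology
open scoped ENNReal RealInnerProductSpace

/-! ### Slicing along a direction -/

section Slicing

variable {V : Type*} [NormedAddCommGroup V] [InnerProductSpace ℝ V] [FiniteDimensional ℝ V]
  [MeasurableSpace V] [BorelSpace V]

theorem measurePreserving_add_orthogonal (W : Submodule ℝ V) :
    MeasurePreserving (fun q : W × Wᗮ => (q.1 : V) + q.2) (volume.prod volume) volume := by
  have h := (W.measurePreserving_measurableEquivProd (0 : V)).symm
  rw [InnerProductSpace.euclideanHausdorffMeasure_eq_volume] at h
  have h' : ⇑(W.measurableEquivProd (0 : V)).symm = fun q : W × Wᗮ => (q.1 : V) + q.2 := by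
    ext q; simp
  rwa [h'] at h

/-- Fubini's theorem along a unit vector `ξ`: the map `(y, t) ↦ y + t ξ` from `ξ^⊥ × ℝ` is
measure preserving. -/
theorem measurePreserving_add_smul {ξ : V} (hξ : ‖ξ‖ = 1) :
    MeasurePreserving
      (fun q : (Submodule.span ℝ {ξ})ᗮ × ℝ => (q.1 : V) + q.2 • ξ)
      (volume.prod volume) volume := by
  have h0 : MeasurePreserving (LinearIsometryEquiv.toSpanUnitSingleton ξ hξ) volume volume :=
    (LinearIsometryEquiv.toSpanUnitSingleton ξ hξ).measurePreserving
  have h1 := h0.prod (.id (volume : Measure (Submodule.span ℝ {ξ})ᗮ))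
  have h2 : MeasurePreserving (Prod.swap : (Submodule.span ℝ {ξ})ᗮ × ℝ → _)
      (volume.prod volume) (volume.prod volume) := Measure.measurePreserving_swap
  have h3 := h1.comp h2
  have h4 := (measurePreserving_add_orthogonal (Submodule.span ℝ {ξ})).comp h3
  have h5 : ((fun q : Submodule.span ℝ {ξ} × (Submodule.span ℝ {ξ})ᗮ => (q.1 : V) + q.2) ∘
      Prod.map (LinearIsometryEquiv.toSpanUnitSingleton ξ hξ) id ∘ Prod.swap) =
      fun q : (Submodule.span ℝ {ξ})ᗮ × ℝ => (q.1 : V) + q.2 • ξ := by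
    ext q
    simp [add_comm]
  rwa [h5] at h4

theorem lintegral_slice {ξ : V} (hξ : ‖ξ‖ = 1) {f : V → ℝ≥0∞} (hf : Measurable f) :
    ∫⁻ x, f x = ∫⁻ t : ℝ, ∫⁻ y : (Submodule.span ℝ {ξ})ᗮ, f ((y : V) + t • ξ) := by
  rw [← (measurePreserving_add_smul hξ).lintegral_comp hf, lintegral_prod_symm]
  exact (hf.comp (measurePreserving_add_smul hξ).measurable).aemeasurable

theorem lintegral_slice' {ξ : V} (hξ : ‖ξ‖ = 1) {f : V → ℝ≥0∞} (hf : Measurable f) :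
    ∫⁻ x, f x = ∫⁻ y : (Submodule.span ℝ {ξ})ᗮ, ∫⁻ t : ℝ, f ((y : V) + t • ξ) := by
  rw [← (measurePreserving_add_smul hξ).lintegral_comp hf, lintegral_prod]
  exact (hf.comp (measurePreserving_add_smul hξ).measurable).aemeasurable

theorem finrank_orthogonal_span {ξ : V} (hξ : ‖ξ‖ = 1) :
    Module.finrank ℝ (Submodule.span ℝ {ξ})ᗮ = Module.finrank ℝ V - 1 := by
  have h := (Submodule.span ℝ {ξ}).finrank_add_finrank_orthogonal
  rw [finrank_span_singleton (by rintro rfl; simp at hξ)] at h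
  omega

end Slicing

/-! ### Polar coordinates -/

section Polar

variable {V : Type*} [NormedAddCommGroup V] [InnerProductSpace ℝ V] [FiniteDimensional ℝ V]
  [MeasurableSpace V] [BorelSpace V]

theorem lintegral_volumeIoiPow (m : ℕ) {g : ℝ → ℝ≥0∞} (hg : Measurable g) :
    ∫⁻ r : Ioi (0 : ℝ), g r ∂(Measure.volumeIoiPow m)
      = ∫⁻ r in Ioi (0 : ℝ), ENNReal.ofReal (r ^ m) * g r := by
  rw [Measure.volumeIoiPow, lintegral_withDensity_eq_lintegral_mul _ (by fun_prop)
    (g := fun r : Ioi (0 : ℝ) => g r) (hg.comp measurable_subtype_coe)]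
  exact lintegral_subtype_comap measurableSet_Ioi (fun r => ENNReal.ofReal (r ^ m) * g r)

theorem lintegral_polar_prod [Nontrivial V] {f : V → ℝ≥0∞} (hf : Measurable f) :
    ∫⁻ x, f x = ∫⁻ q : sphere (0 : V) 1 × Ioi (0 : ℝ), f ((q.2 : ℝ) • (q.1 : V))
      ∂((volume : Measure V).toSphere.prod
        (Measure.volumeIoiPow (Module.finrank ℝ V - 1))) := by
  have h := (volume : Measure V).measurePreserving_homeomorphUnitSphereProd
  have hm : Measurable fun q : sphere (0 : V) 1 × Ioi (0 : ℝ) => f ((q.2 : ℝ) • (q.1 : V)) := by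
    fun_prop
  rw [← h.lintegral_comp hm]
  calc ∫⁻ x, f x = ∫⁻ x in ({0}ᶜ : Set V), f x := by rw [restrict_compl_singleton]
    _ = ∫⁻ x : ({0}ᶜ : Set V), f x ∂(volume.comap Subtype.val) :=
      (lintegral_subtype_comap (measurableSet_singleton _).compl f).symm
    _ = _ := by
      refine lintegral_congr fun x => ?_
      have hx : ‖(x : V)‖ ≠ 0 := norm_ne_zero_iff.2 x.2
      simp [smul_smul, hx]

/-- Polar coordinates. -/
theorem lintegral_polar [Nontrivial V] {f : V → ℝ≥0∞} (hf : Measurable f) :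
    ∫⁻ x, f x = ∫⁻ ξ : sphere (0 : V) 1, ∫⁻ r in Ioi (0 : ℝ),
      ENNReal.ofReal (r ^ (Module.finrank ℝ V - 1)) * f (r • (ξ : V))
        ∂volume ∂(volume : Measure V).toSphere := by
  rw [lintegral_polar_prod hf, lintegral_prod]
  · refine lintegral_congr fun ξ => ?_
    exact lintegral_volumeIoiPow _ (g := fun r => f (r • (ξ : V))) (by fun_prop)
  · exact Measurable.aemeasurable (by fun_prop)

end Polar

/-! ### Ray gauges -/

/-- A continuous, positively homogeneous function that is positive off the origin: these are the
Minkowski functionals of star bodies. -/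
structure IsRayGauge {V : Type*} [NormedAddCommGroup V] [NormedSpace ℝ V] (p : V → ℝ) : Prop where
  continuous : Continuous p
  smul_of_nonneg : ∀ (t : ℝ) (x : V), 0 ≤ t → p (t • x) = t * p x
  pos : ∀ x, x ≠ 0 → 0 < p x

namespace IsRayGauge

section General

variable {V : Type*} [NormedAddCommGroup V] [NormedSpace ℝ V] {p : V → ℝ}

theorem map_zero (hp : IsRayGauge p) : p 0 = 0 := by
  simpa using hp.smul_of_nonneg 0 0 le_rfl

theorem pos_sphere (hp : IsRayGauge p) (ξ : sphere (0 : V) 1) : 0 < p ξ :=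
  hp.pos _ (ne_zero_of_mem_unit_sphere ξ)

theorem nonneg (hp : IsRayGauge p) (x : V) : 0 ≤ p x := by
  rcases eq_or_ne x 0 with rfl | h
  · exact hp.map_zero.ge
  · exact (hp.pos x h).le

/-- Restriction of a ray gauge along an injective linear map. -/
theorem comp_linear (hp : IsRayGauge p) {W : Type*} [NormedAddCommGroup W] [NormedSpace ℝ W]
    (T : W →L[ℝ] V) (hT : Function.Injective T) : IsRayGauge fun w => p (T w) where
  continuous := hp.continuous.comp T.continuous
  smul_of_nonneg t x ht := by simp [hp.smul_of_nonneg t _ ht]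
  pos x hx := hp.pos _ ((map_ne_zero_iff T hT).2 hx)

theorem norm : IsRayGauge fun x : V => ‖x‖ where
  continuous := continuous_norm
  smul_of_nonneg t x ht := by simp [norm_smul, abs_of_nonneg ht]
  pos x hx := norm_pos_iff.2 hx

theorem const_mul (hp : IsRayGauge p) {a : ℝ} (ha : 0 < a) : IsRayGauge fun x => a * p x where
  continuous := hp.continuous.const_mul a
  smul_of_nonneg t x ht := by rw [hp.smul_of_nonneg t _ ht]; ring
  pos x hx := mul_pos ha (hp.pos x hx)

variable [FiniteDimensional ℝ V]

theorem exists_mul_norm_le (hp : IsRayGauge p) : ∃ a : ℝ, 0 < a ∧ ∀ x, a * ‖x‖ ≤ p x := by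
  have hc : IsCompact (sphere (0 : V) 1) := isCompact_sphere 0 1
  rcases (sphere (0 : V) 1).eq_empty_or_nonempty with h | h
  · refine ⟨1, one_pos, fun x => ?_⟩
    rcases eq_or_ne x 0 with rfl | hx
    · simp [hp.map_zero]
    · exact absurd (show ‖x‖⁻¹ • x ∈ sphere (0 : V) 1 by simp [norm_smul, hx]) (by simp [h])
  · obtain ⟨ξ, hξ, hmin⟩ := hc.exists_isMinOn h hp.continuous.continuousOn
    refine ⟨p ξ, hp.pos_sphere ⟨ξ, hξ⟩, fun x => ?_⟩
    rcases eq_or_ne x 0 with rfl | hx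
    · simp [hp.map_zero]
    · have h1 : ‖x‖⁻¹ • x ∈ sphere (0 : V) 1 := by simp [norm_smul, hx]
      have h2 : p ξ ≤ p (‖x‖⁻¹ • x) := hmin h1
      rw [hp.smul_of_nonneg _ _ (by positivity)] at h2
      have h3 : 0 < ‖x‖ := norm_pos_iff.2 hx
      calc p ξ * ‖x‖ ≤ ‖x‖⁻¹ * p x * ‖x‖ := by gcongr
        _ = p x := by field_simp

theorem exists_subset_closedBall (hp : IsRayGauge p) :
    ∃ R : ℝ, 0 < R ∧ {x | p x ≤ 1} ⊆ closedBall 0 R := by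
  obtain ⟨a, ha, h⟩ := hp.exists_mul_norm_le
  refine ⟨a⁻¹, by positivity, fun x hx => ?_⟩
  have := (h x).trans hx
  rw [mem_closedBall_zero_iff, inv_eq_one_div, le_div_iff₀ ha]
  linarith

theorem isClosed_le (hp : IsRayGauge p) : IsClosed {x | p x ≤ 1} :=
  _root_.isClosed_le hp.continuous continuous_const

theorem isCompact_le (hp : IsRayGauge p) : IsCompact {x | p x ≤ 1} := by
  obtain ⟨R, -, hR⟩ := hp.exists_subset_closedBall
  exact (isCompact_closedBall 0 R).of_isClosed_subset hp.isClosed_le hR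

end General

section Volume

variable {V : Type*} [NormedAddCommGroup V] [InnerProductSpace ℝ V] [FiniteDimensional ℝ V]
  [MeasurableSpace V] [BorelSpace V] {p : V → ℝ}

theorem volume_le_lt_top (hp : IsRayGauge p) : volume {x | p x ≤ 1} < ∞ :=
  hp.isCompact_le.measure_lt_top

theorem smul_le_one_iff (hp : IsRayGauge p) (ξ : sphere (0 : V) 1) {r : ℝ} (hr : 0 < r) :
    p (r • (ξ : V)) ≤ 1 ↔ r ≤ (p ξ)⁻¹ := by
  rw [hp.smul_of_nonneg _ _ hr.le, inv_eq_one_div, le_div_iff₀ (hp.pos_sphere ξ)]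

theorem lintegral_Ioc_pow (m : ℕ) {a : ℝ} (ha : 0 ≤ a) :
    ∫⁻ r in Ioc 0 a, ENNReal.ofReal (r ^ m) = ENNReal.ofReal (a ^ (m + 1) / (m + 1)) := by
  rw [← ofReal_integral_eq_lintegral_ofReal, ← intervalIntegral.integral_of_le ha]
  · simp
  · exact (intervalIntegral.intervalIntegrable_pow m).1
  · filter_upwards [ae_restrict_mem measurableSet_Ioc] with y hy using pow_nonneg hy.1.le _

/-- The volume of a star body in polar coordinates. -/
theorem volume_le_one [Nontrivial V] (hp : IsRayGauge p) :
    volume {x | p x ≤ 1} = ∫⁻ ξ : sphere (0 : V) 1,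
      ENNReal.ofReal ((p ξ)⁻¹ ^ Module.finrank ℝ V / Module.finrank ℝ V)
        ∂(volume : Measure V).toSphere := by
  have hd : 0 < Module.finrank ℝ V := Module.finrank_pos
  have hm : MeasurableSet {x | p x ≤ 1} := hp.isClosed_le.measurableSet
  rw [← lintegral_indicator_one hm, lintegral_polar (measurable_one.indicator hm)]
  refine lintegral_congr fun ξ => ?_
  have hξ := hp.pos_sphere ξ
  have h1 : ∀ r ∈ Ioi (0 : ℝ), ENNReal.ofReal (r ^ (Module.finrank ℝ V - 1)) *
      ({x | p x ≤ 1}.indicator 1 (r • (ξ : V)) : ℝ≥0∞) =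
      (Iic (p ξ)⁻¹).indicator (fun r => ENNReal.ofReal (r ^ (Module.finrank ℝ V - 1))) r := by
    intro r hr
    have := hp.smul_le_one_iff ξ hr
    by_cases h : r ≤ (p ξ)⁻¹ <;> simp [indicator, this, h]
  rw [setLIntegral_congr_fun measurableSet_Ioi h1, setLIntegral_indicator measurableSet_Iic,
    Iic_inter_Ioi, lintegral_Ioc_pow _ (by positivity), Nat.sub_add_cancel hd]
  congr 3
  rw [Nat.cast_sub hd]; simp

/-- The boundary of a star body is a null set, since every ray meets it once. -/
theorem volume_eq_one [Nontrivial V] (hp : IsRayGauge p) : volume {x | p x = 1} = 0 := by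
  have hm : MeasurableSet {x | p x = 1} := hp.continuous.measurable (measurableSet_singleton 1)
  rw [← lintegral_indicator_one hm, lintegral_polar (measurable_one.indicator hm),
    lintegral_eq_zero_iff' (by
      refine Measurable.aemeasurable (Measurable.lintegral_prod_right' (f := fun q :
        sphere (0 : V) 1 × ℝ => ENNReal.ofReal (q.2 ^ (Module.finrank ℝ V - 1)) *
          {x | p x = 1}.indicator 1 (q.2 • (q.1 : V))) ?_)
      have := (measurable_one (α := ℝ≥0∞)).indicator hm
      fun_prop)]
  refine .of_forall fun ξ => ?_
  refine (setLIntegral_congr_fun (g := ({(p ξ)⁻¹} : Set ℝ).indicator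
    (fun r => ENNReal.ofReal (r ^ (Module.finrank ℝ V - 1)))) measurableSet_Ioi ?_).trans ?_
  · intro r hr
    have h0 := hp.pos_sphere ξ
    have : p (r • (ξ : V)) = 1 ↔ r = (p ξ)⁻¹ := by
      rw [hp.smul_of_nonneg _ _ (le_of_lt hr), ← div_inv_eq_mul, div_eq_one_iff_eq (by positivity)]
    simp only [indicator, mem_ofPred_eq, mem_singleton_iff, this]
    split_ifs <;> simp
  · rw [setLIntegral_indicator (measurableSet_singleton _)]
    exact setLIntegral_measure_zero _ _ (measure_mono_null inter_subset_left (by simp))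

theorem integrable_sphere (hp : IsRayGauge p) (m : ℕ) :
    Integrable (fun ξ : sphere (0 : V) 1 => (p ξ)⁻¹ ^ m) (volume : Measure V).toSphere := by
  have : Continuous fun ξ : sphere (0 : V) 1 => (p ξ)⁻¹ ^ m :=
    ((hp.continuous.comp continuous_subtype_val).inv₀ fun ξ => (hp.pos_sphere ξ).ne').pow m
  exact this.integrable_of_hasCompactSupport (.of_compactSpace _)

/-- The volume in polar coordinates, as a Bochner integral over the sphere. -/
theorem real_volume_le_one [Nontrivial V] (hp : IsRayGauge p) :
    volume.real {x | p x ≤ 1} = (∫ ξ : sphere (0 : V) 1, (p ξ)⁻¹ ^ Module.finrank ℝ V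
      ∂(volume : Measure V).toSphere) / Module.finrank ℝ V := by
  rw [← integral_div, integral_eq_lintegral_of_nonneg_ae, measureReal_def, hp.volume_le_one]
  · exact .of_forall fun ξ => div_nonneg (pow_nonneg (inv_nonneg.2 (hp.nonneg _)) _) (by simp)
  · exact ((hp.integrable_sphere _).div_const _).aestronglyMeasurable

end Volume

end IsRayGauge

/-! ### Star bodies and their Minkowski functionals -/

section StarBody

variable {n : ℕ} {K : Set (E n)} {p : E n → ℝ}

theorem IsStarBody.isRayGauge (hK : IsStarBody K) : IsRayGauge (gauge K) where
  continuous := hK.continuous_gauge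
  smul_of_nonneg t x ht := by rw [gauge_smul_of_nonneg ht, smul_eq_mul]
  pos x hx := by
    rwa [gauge_pos (absorbent_nhds_zero (mem_interior_iff_mem_nhds.1 hK.zero_mem_interior))
      ((NormedSpace.isVonNBounded_iff ℝ).2 hK.isBounded)]

/-- A star body is the sublevel set of its Minkowski functional. If `gauge K x ≤ 1` but `x ∉ K`,
then some `x / r` with `r < 1` lies in `K`, and the line through `x` meets the boundary between
`0` and `x`, between `x` and `x / r`, and on the opposite ray: three times. -/
theorem IsStarBody.gauge_le_one_iff (hK : IsStarBody K) (x : E n) : gauge K x ≤ 1 ↔ x ∈ K := by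
  refine ⟨fun hx => ?_, gauge_le_one_of_mem⟩
  by_contra hxK
  have hnhds := mem_interior_iff_mem_nhds.1 hK.zero_mem_interior
  have h0K : (0 : E n) ∈ K := interior_subset hK.zero_mem_interior
  have hx0 : x ≠ 0 := by rintro rfl; exact hxK h0K
  have hcont : Continuous fun t : ℝ => t • x := by fun_prop
  have hpre : IsClosed ((fun t : ℝ => t • x) ⁻¹' K) := hK.isClosed.preimage hcont
  obtain ⟨t, ht1, htK⟩ : ∃ t : ℝ, 1 < t ∧ t • x ∈ K := by
    have hev : ∀ᶠ t : ℝ in 𝓝 1, t • x ∉ K := by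
      refine hpre.isOpen_compl.mem_nhds ?_
      simpa using hxK
    have hev' : ∀ᶠ r : ℝ in 𝓝 1, r⁻¹ • x ∉ K := by
      have : Tendsto (fun r : ℝ => r⁻¹) (𝓝 1) (𝓝 1) := by
        simpa using (continuousAt_inv₀ (one_ne_zero (α := ℝ))).tendsto
      exact this.eventually hev
    obtain ⟨ε, hε, hball⟩ := Metric.eventually_nhds_iff.1 hev'
    obtain ⟨r, hr0, hr1, k, hk, hkx⟩ := exists_lt_of_gauge_lt (absorbent_nhds_zero hnhds)
      (show gauge K x < 1 + ε by linarith)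
    have hkx' : r⁻¹ • x = k := by
      rw [← hkx]; simp [smul_smul, hr0.ne']
    have hr : r < 1 := by
      by_contra hge
      push Not at hge
      exact hball (y := r) (by rw [Real.dist_eq, abs_of_nonneg (by linarith)]; linarith)
        (hkx' ▸ hk)
    exact ⟨r⁻¹, (one_lt_inv₀ hr0).2 hr, hkx' ▸ hk⟩
  obtain ⟨M, hM0, hMK⟩ : ∃ M : ℝ, 0 < M ∧ (-M) • x ∉ K := by
    obtain ⟨R, hR⟩ := hK.isBounded.subset_closedBall 0
    have hxn : 0 < ‖x‖ := norm_pos_iff.2 hx0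
    refine ⟨(|R| + 1) / ‖x‖, by positivity, fun h => ?_⟩
    have h2 := hR h
    rw [mem_closedBall_zero_iff, norm_smul, norm_neg, Real.norm_of_nonneg (by positivity),
      div_mul_cancel₀ _ hxn.ne'] at h2
    linarith [le_abs_self R]
  -- boundary points on a segment joining a point of `K` to a point outside `K`
  have key : ∀ a b : ℝ, ∀ c ∈ Icc a b, ∀ d ∈ Icc a b, c • x ∈ K → d • x ∉ K →
      ∃ s ∈ Icc a b, s • x ∈ frontier K := by
    intro a b c hc d hd hcK hdK
    have hconn : IsPreconnected ((fun t : ℝ => t • x) '' Icc a b) :=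
      isPreconnected_Icc.image _ hcont.continuousOn
    by_contra! hno
    have hint : ∀ s ∈ Icc a b, s • x ∈ K → s • x ∈ interior K := fun s hs hsK => by
      by_contra h
      exact hno s hs (by rw [hK.isClosed.frontier_eq]; exact ⟨hsK, h⟩)
    obtain ⟨y, -, hy, hy'⟩ := hconn (interior K) Kᶜ isOpen_interior hK.isClosed.isOpen_compl
      (by
        rintro _ ⟨s, hs, rfl⟩
        by_cases h : s • x ∈ K
        · exact Or.inl (hint s hs h)
        · exact Or.inr h)
      ⟨c • x, ⟨c, hc, rfl⟩, hint c hc hcK⟩ ⟨d • x, ⟨d, hd, rfl⟩, hdK⟩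
    exact hy' (interior_subset hy)
  have hfne : ∀ y ∈ frontier K, y ≠ 0 ∧ y ≠ x := by
    refine fun y hy => ⟨?_, ?_⟩
    · rintro rfl
      exact disjoint_interior_frontier.ne_of_mem hK.zero_mem_interior hy rfl
    · rintro rfl
      exact hxK (hK.isClosed.frontier_subset hy)
  obtain ⟨s₁, hs₁, hf₁⟩ := key 0 1 0 (by simp) 1 (by simp) (by simpa using h0K) (by simpa using hxK)
  obtain ⟨s₂, hs₂, hf₂⟩ := key 1 t t (by simp [ht1.le]) 1 (by simp [ht1.le]) htK (by simpa using hxK)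
  obtain ⟨s₃, hs₃, hf₃⟩ := key (-M) 0 0 (by simp [hM0.le]) (-M) (by simp [hM0.le])
    (by simpa using h0K) hMK
  have hs₁' : s₁ ≠ 1 := by rintro rfl; exact (hfne _ hf₁).2 (one_smul _ _)
  have hs₂' : s₂ ≠ 1 := by rintro rfl; exact (hfne _ hf₂).2 (one_smul _ _)
  have hs₁'' : s₁ ≠ 0 := by rintro rfl; exact (hfne _ hf₁).1 (zero_smul _ _)
  have hs₃' : s₃ ≠ 0 := by rintro rfl; exact (hfne _ hf₃).1 (zero_smul _ _)
  have hlt₁ : s₁ < 1 := lt_of_le_of_ne hs₁.2 hs₁'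
  have hlt₂ : 1 < s₂ := lt_of_le_of_ne hs₂.1 hs₂'.symm
  have hlt₃ : s₃ < 0 := lt_of_le_of_ne hs₃.2 hs₃'
  have hinj : Function.Injective fun t : ℝ => t • x := smul_left_injective ℝ hx0
  have hcard := hK.line_boundary x hx0
  have hsub : (({s₁ • x, s₂ • x, s₃ • x} : Finset (E n)) : Set (E n)) ⊆
      {y | y ∈ Submodule.span ℝ {x} ∧ y ∈ frontier K ∧ y ≠ 0} := by
    intro y hy
    simp only [Finset.coe_insert, Finset.coe_singleton, mem_insert_iff, mem_singleton_iff] at hy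
    rcases hy with rfl | rfl | rfl
    · exact ⟨Submodule.smul_mem _ _ (Submodule.mem_span_singleton_self x), hf₁, (hfne _ hf₁).1⟩
    · exact ⟨Submodule.smul_mem _ _ (Submodule.mem_span_singleton_self x), hf₂, (hfne _ hf₂).1⟩
    · exact ⟨Submodule.smul_mem _ _ (Submodule.mem_span_singleton_self x), hf₃, (hfne _ hf₃).1⟩
  have h3 : ({s₁ • x, s₂ • x, s₃ • x} : Finset (E n)).card = 3 := by
    refine Finset.card_eq_three.2 ⟨_, _, _, ?_, ?_, ?_, rfl⟩
    · exact fun h => absurd (hinj h) (by linarith : s₁ < s₂).ne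
    · exact fun h => absurd (hinj h) (by linarith [hs₁.1] : s₃ < s₁).ne'
    · exact fun h => absurd (hinj h) (by linarith : s₃ < s₂).ne'
  have hfin : {y | y ∈ Submodule.span ℝ {x} ∧ y ∈ frontier K ∧ y ≠ 0}.Finite :=
    finite_of_ncard_ne_zero (by rw [hcard]; norm_num)
  have := ncard_le_ncard hsub hfin
  rw [ncard_coe_finset, h3, hcard] at this
  omega

theorem IsStarBody.setOf_gauge_le_one (hK : IsStarBody K) : {x | gauge K x ≤ 1} = K :=
  ext hK.gauge_le_one_iff

/-- A ray gauge is the Minkowski functional of its sublevel set. -/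
theorem IsRayGauge.gauge_eq (hp : IsRayGauge p) : gauge {x | p x ≤ 1} = p := by
  ext x
  have hset : ∀ r : ℝ, 0 < r → (r⁻¹ • x ∈ {x | p x ≤ 1} ↔ p x ≤ r) := fun r hr => by
    rw [mem_ofPred_eq, hp.smul_of_nonneg _ _ (by positivity), inv_mul_le_iff₀ hr, mul_one]
  rw [gauge_def']
  rcases eq_or_ne x 0 with rfl | hx
  · have : {r : ℝ | r ∈ Ioi (0 : ℝ) ∧ r⁻¹ • (0 : E n) ∈ {x | p x ≤ 1}} = Ioi 0 := by
      ext r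
      simp [hp.map_zero]
    rw [this, csInf_Ioi, hp.map_zero]
  · have : {r : ℝ | r ∈ Ioi (0 : ℝ) ∧ r⁻¹ • x ∈ {x | p x ≤ 1}} = Ici (p x) := by
      ext r
      constructor
      · rintro ⟨hr, h⟩
        exact (hset r hr).1 h
      · intro h
        have hr : 0 < r := (hp.pos x hx).trans_le h
        exact ⟨hr, (hset r hr).2 h⟩
    rw [this, csInf_Ici]

theorem IsRayGauge.frontier_le_one (hp : IsRayGauge p) : frontier {x | p x ≤ 1} = {x | p x = 1} := by
  refine Subset.antisymm (frontier_le_subset_eq hp.continuous continuous_const) fun x hx => ?_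
  rw [hp.isClosed_le.frontier_eq]
  refine ⟨hx.le, fun hint => ?_⟩
  have hcont : Tendsto (fun t : ℝ => t • x) (𝓝 1) (𝓝 x) := by
    simpa using (show Continuous fun t : ℝ => t • x by fun_prop).tendsto 1
  have hev := hcont.eventually (mem_interior_iff_mem_nhds.1 hint)
  obtain ⟨ε, hε, h⟩ := Metric.eventually_nhds_iff.1 hev
  have h1 := h (y := 1 + ε / 2) (by
    rw [Real.dist_eq, add_sub_cancel_left, abs_of_pos (by positivity)]; linarith)
  rw [hp.smul_of_nonneg _ _ (by positivity), show p x = 1 from hx] at h1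
  linarith

/-- The sublevel set of an even ray gauge is a star body: as the gauge is even, the line through `u`
meets the boundary exactly at `± u / p u`. -/
theorem IsRayGauge.isStarBody (hp : IsRayGauge p) (heven : ∀ x, p (-x) = p x) :
    IsStarBody {x | p x ≤ 1} where
  isClosed := hp.isClosed_le
  isBounded := hp.isCompact_le.isBounded
  zero_mem_interior := by
    refine mem_interior_iff_mem_nhds.2 ?_
    have : ∀ᶠ x in 𝓝 (0 : E n), p x < 1 :=
      (hp.continuous.tendsto 0).eventually (gt_mem_nhds (by rw [hp.map_zero]; exact one_pos))
    exact this.mono fun x hx => hx.le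
  line_boundary u hu := by
    have hpu := hp.pos u hu
    have habs : ∀ t : ℝ, p (t • u) = |t| * p u := fun t => by
      rcases le_total 0 t with ht | ht
      · rw [hp.smul_of_nonneg _ _ ht, abs_of_nonneg ht]
      · rw [← heven, ← neg_smul, hp.smul_of_nonneg _ _ (neg_nonneg.2 ht), abs_of_nonpos ht]
    have : {x | x ∈ Submodule.span ℝ {u} ∧ x ∈ frontier {x | p x ≤ 1} ∧ x ≠ 0} =
        {(p u)⁻¹ • u, -((p u)⁻¹ • u)} := by
      ext x
      rw [hp.frontier_le_one]
      simp only [mem_ofPred_eq, mem_insert_iff, mem_singleton_iff]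
      constructor
      · rintro ⟨hx, h1, -⟩
        obtain ⟨t, rfl⟩ := Submodule.mem_span_singleton.1 hx
        rw [habs, ← eq_div_iff hpu.ne', one_div] at h1
        rcases abs_choice t with h | h
        · left; rw [← h1, h]
        · right; rw [← h1, h]; simp
      · have hne : (p u)⁻¹ • u ≠ 0 := smul_ne_zero (inv_ne_zero hpu.ne') hu
        have h1 : p ((p u)⁻¹ • u) = 1 := by
          rw [hp.smul_of_nonneg _ _ (by positivity), inv_mul_cancel₀ hpu.ne']
        have hmem : (p u)⁻¹ • u ∈ Submodule.span ℝ {u} :=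
          Submodule.smul_mem _ _ (Submodule.mem_span_singleton_self u)
        rintro (rfl | rfl)
        · exact ⟨hmem, h1, hne⟩
        · exact ⟨Submodule.neg_mem _ hmem, by rw [heven, h1], neg_ne_zero.2 hne⟩
    rw [this, ncard_pair]
    intro h
    have h2 : (2 : ℝ) • ((p u)⁻¹ • u) = 0 := by rw [two_smul]; nth_rw 1 [h]; simp
    exact smul_ne_zero two_ne_zero (smul_ne_zero (inv_ne_zero hpu.ne') hu) h2
  continuous_gauge := by rw [hp.gauge_eq]; exact hp.continuous

theorem IsRayGauge.isOriginSymmetric (heven : ∀ x, p (-x) = p x) :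
    IsOriginSymmetric {x | p x ≤ 1} := by
  ext x
  simp [heven]

theorem IsOriginSymmetric.gauge_neg (hK : IsOriginSymmetric K) (x : E n) :
    gauge K (-x) = gauge K x :=
  _root_.gauge_neg (fun y hy => by rw [← hK]; simpa using hy) x

/-- Every positive continuous even function on the sphere is the radial function of an even ray
gauge. -/
theorem exists_isRayGauge_of_radial {ρ : E n → ℝ} (hc : ContinuousOn ρ (unitSphere n))
    (hpos : ∀ ξ ∈ unitSphere n, 0 < ρ ξ) (heven : ∀ ξ ∈ unitSphere n, ρ (-ξ) = ρ ξ) :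
    ∃ p : E n → ℝ, IsRayGauge p ∧ (∀ x, p (-x) = p x) ∧ ∀ ξ ∈ unitSphere n, (p ξ)⁻¹ = ρ ξ := by
  have hmem : ∀ x : E n, x ≠ 0 → ‖x‖⁻¹ • x ∈ unitSphere n := fun x hx => by
    simp [norm_smul, hx]
  obtain ⟨C, hC⟩ := (isCompact_sphere (0 : E n) 1).exists_bound_of_continuousOn
    (hc.inv₀ fun ξ hξ => (hpos ξ hξ).ne')
  refine ⟨fun x => ‖x‖ * (ρ (‖x‖⁻¹ • x))⁻¹, ⟨?_, ?_, ?_⟩, ?_, ?_⟩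
  · rw [continuous_iff_continuousAt]
    intro x
    rcases eq_or_ne x 0 with rfl | hx
    · have : Tendsto (fun x : E n => ‖x‖ * C) (𝓝 0) (𝓝 0) := by
        simpa using (show Continuous fun x : E n => ‖x‖ * C by fun_prop).tendsto 0
      have h := squeeze_zero_norm (f := fun x : E n => ‖x‖ * (ρ (‖x‖⁻¹ • x))⁻¹) (fun x => ?_) this
      · simpa [ContinuousAt] using h
      · rcases eq_or_ne x 0 with rfl | hx
        · simp
        · rw [norm_mul, norm_norm]
          exact mul_le_mul_of_nonneg_left (hC _ (hmem x hx)) (norm_nonneg _)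
    · have h1 : ContinuousOn (fun x : E n => ‖x‖⁻¹ • x) {0}ᶜ :=
        (continuousOn_id.norm.inv₀ fun y hy => norm_ne_zero_iff.2 hy).smul continuousOn_id
      have h2 : ContinuousOn (fun x : E n => (ρ (‖x‖⁻¹ • x))⁻¹) {0}ᶜ :=
        (hc.comp h1 fun y hy => hmem y hy).inv₀ fun y hy => (hpos _ (hmem y hy)).ne'
      exact (continuousOn_id.norm.mul h2).continuousAt
        (isOpen_compl_singleton.mem_nhds hx)
  · intro t x ht
    rcases ht.eq_or_lt with rfl | ht
    · simp
    · have : ‖t • x‖⁻¹ • t • x = ‖x‖⁻¹ • x := by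
        rw [norm_smul, Real.norm_of_nonneg ht.le, smul_smul]
        congr 1
        rw [mul_inv]
        field_simp
      simp only [this]
      rw [norm_smul, Real.norm_of_nonneg ht.le]
      ring
  · intro x hx
    exact mul_pos (norm_pos_iff.2 hx) (inv_pos.2 (hpos _ (hmem x hx)))
  · intro x
    rcases eq_or_ne x 0 with rfl | hx
    · simp
    · simp only [norm_neg, smul_neg]
      rw [heven _ (hmem x hx)]
  · intro ξ hξ
    have : ‖ξ‖ = 1 := by simpa using hξ
    simp [this]

end StarBody

/-! ### Continuity of the section function -/

section SectionContinuity

theorem volume_submodule_map {V : Type*} [NormedAddCommGroup V] [InnerProductSpace ℝ V]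
    [FiniteDimensional ℝ V] [MeasurableSpace V] [BorelSpace V] {A B : Submodule ℝ V}
    (e : V ≃ₗᵢ[ℝ] V) (h : A.map e.toLinearEquiv.toLinearMap = B) {s : Set V}
    (hs : MeasurableSet s) :
    volume {z : B | (z : V) ∈ s} = volume {z : A | e z ∈ s} := by
  subst h
  have := (e.submoduleMap A).measurePreserving.measure_preimage
    (s := {z : A.map e.toLinearEquiv.toLinearMap | (z : V) ∈ s})
    (measurable_subtype_coe hs).nullMeasurableSet
  exact this.symm

/-- The sections of a star body depend continuously on the direction: after they are reflected into one
hyperplane, their indicator functions converge off the boundary, which is a null set. -/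
theorem continuousOn_volume_section {n : ℕ} (hn : 2 ≤ n) {p : E n → ℝ} (hp : IsRayGauge p) :
    ContinuousOn (fun ξ : E n => volume {z : perp ξ | p z ≤ 1}) (unitSphere n) := by
  intro ξ₀ hξ₀
  have hξ₀n : ‖ξ₀‖ = 1 := by simpa using hξ₀
  -- the reflection across `(ξ + ξ₀)^⊥` carries `ξ₀^⊥` onto `ξ^⊥`, continuously in `ξ`
  let T : E n → E n ≃ₗᵢ[ℝ] E n := fun ξ => (Submodule.span ℝ {ξ₀ + ξ})ᗮ.reflection
  have hT : ∀ ξ ∈ unitSphere n,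
      volume {z : perp ξ | p z ≤ 1} = volume {z : perp ξ₀ | p (T ξ z) ≤ 1} := by
    intro ξ hξ
    have hξn : ‖ξ‖ = 1 := by simpa using hξ
    refine volume_submodule_map (T ξ) ?_ hp.isClosed_le.measurableSet
    have h1 : T ξ ξ₀ = -ξ := by
      have := Submodule.reflection_sub (v := ξ₀) (w := -ξ) (by rw [norm_neg, hξn, hξ₀n])
      simpa [T] using this
    have h2 := Submodule.map_orthogonal_equiv (Submodule.span ℝ {ξ₀}) (T ξ)
    have h3 : Submodule.map (T ξ).toLinearEquiv.toLinearMap (Submodule.span ℝ {ξ₀}) =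
        Submodule.span ℝ {ξ} := by
      rw [Submodule.map_span, image_singleton]
      change Submodule.span ℝ {T ξ ξ₀} = _
      rw [h1, ← Set.neg_singleton, Submodule.span_neg]
    rw [h3] at h2
    exact h2
  refine ContinuousWithinAt.congr ?_ hT (hT _ hξ₀)
  obtain ⟨R, -, hRp⟩ := hp.exists_subset_closedBall
  have hpr : IsRayGauge fun z : perp ξ₀ => p z :=
    hp.comp_linear (perp ξ₀).subtypeL Subtype.val_injective
  have hm : ∀ ξ, MeasurableSet {z : perp ξ₀ | p (T ξ z) ≤ 1} := fun ξ =>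
    (isClosed_le (hp.continuous.comp ((T ξ).continuous.comp continuous_subtype_val))
      continuous_const).measurableSet
  have hfr : Module.finrank ℝ (perp ξ₀) = n - 1 := by
    rw [finrank_orthogonal_span hξ₀n]; simp
  have : Nontrivial (perp ξ₀) := Module.nontrivial_of_finrank_pos (R := ℝ) (by omega)
  refine tendsto_measure_of_ae_tendsto_indicator (B := closedBall 0 R) _ (hm ξ₀) hm
    measurableSet_closedBall (isCompact_closedBall _ _).measure_lt_top.ne (.of_forall ?_) ?_
  · intro ξ z hz
    have := hRp (show T ξ z ∈ {x | p x ≤ 1} from hz)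
    simpa using this
  · have hnull : ∀ᵐ z : perp ξ₀, p z ≠ 1 := by
      have := hpr.volume_eq_one
      rwa [measure_eq_zero_iff_ae_notMem] at this
    filter_upwards [hnull] with z hz
    have hT₀ : T ξ₀ z = z := by
      have hz' : (z : E n) ∈ (Submodule.span ℝ {ξ₀ + ξ₀})ᗮ := by
        have := z.2
        rw [Submodule.mem_orthogonal_singleton_iff_inner_right] at this ⊢
        rw [inner_add_left, this, add_zero]
      exact Submodule.reflection_mem_subspace_eq_self hz'
    have hcont : ContinuousAt (fun ξ => p (T ξ z)) ξ₀ := by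
      have hTz : ∀ ξ, T ξ z = -((2 : ℝ) • ((⟪ξ₀ + ξ, (z : E n)⟫ / ‖ξ₀ + ξ‖ ^ 2) • (ξ₀ + ξ)) - z) := by
        intro ξ
        simp only [T, Submodule.reflection_orthogonal_apply, Submodule.reflection_singleton_apply]
        norm_num [two_smul]
      simp only [hTz]
      refine hp.continuous.continuousAt.comp ?_
      have : ‖ξ₀ + ξ₀‖ ^ 2 ≠ 0 := by
        rw [← two_smul ℝ, norm_smul, hξ₀n]; norm_num
      have h1 : ContinuousAt (fun ξ => ⟪ξ₀ + ξ, (z : E n)⟫ / ‖ξ₀ + ξ‖ ^ 2) ξ₀ :=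
        ContinuousAt.div (by fun_prop) (by fun_prop) this
      fun_prop
    have hlim : Tendsto (fun ξ => p (T ξ z)) (𝓝[unitSphere n] ξ₀) (𝓝 (p z)) := by
      have := hcont.tendsto
      rw [hT₀] at this
      exact this.mono_left nhdsWithin_le_nhds
    simp only [hT₀]
    rcases lt_or_gt_of_ne hz with h | h
    · filter_upwards [hlim.eventually (gt_mem_nhds h)] with ξ hξ
      exact ⟨fun _ => h.le, fun _ => hξ.le⟩
    · filter_upwards [hlim.eventually (lt_mem_nhds h)] with ξ hξ
      exact ⟨fun h' => absurd h' hξ.not_ge, fun h' => absurd h' h.not_ge⟩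

theorem continuousOn_sectionVol {n : ℕ} (hn : 2 ≤ n) {p : E n → ℝ} (hp : IsRayGauge p) :
    ContinuousOn (sectionVol {x | p x ≤ 1}) (unitSphere n) := by
  intro ξ hξ
  refine (ENNReal.tendsto_toReal ?_).comp (continuousOn_volume_section hn hp ξ hξ)
  exact (hp.comp_linear (perp ξ).subtypeL Subtype.val_injective).volume_le_lt_top.ne

end SectionContinuity

/-! ### Self-adjointness of the spherical Radon transform -/

section Duality

variable {n : ℕ} {p q : E n → ℝ}

theorem finrank_perp {ξ : E n} (hξ : ξ ∈ unitSphere n) : Module.finrank ℝ (perp ξ) = n - 1 := by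
  rw [finrank_orthogonal_span (by simpa using hξ)]; simp

/-- All central hyperplanes are isometric to `ℝ^{n-1}`. -/
theorem exists_isometry_perp {ξ : E n} (hξ : ξ ∈ unitSphere n) :
    Nonempty (E (n - 1) ≃ₗᵢ[ℝ] perp ξ) :=
  ⟨((stdOrthonormalBasis ℝ (perp ξ)).reindex (finCongr (finrank_perp hξ))).repr.symm⟩

theorem volume_closedBall_perp {ξ : E n} (hξ : ξ ∈ unitSphere n) (R : ℝ) :
    volume (closedBall (0 : perp ξ) R) = volume (closedBall (0 : E (n - 1)) R) := by
  obtain ⟨e⟩ := exists_isometry_perp hξ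
  rw [← e.measurePreserving.measure_preimage measurableSet_closedBall.nullMeasurableSet]
  congr 1
  ext x
  simp

/-- The volume of the part of a star body in a slab is the integral of its parallel sections. -/
theorem volume_slab (hq : IsRayGauge q) {ξ : E n} (hξ : ξ ∈ unitSphere n) (δ : ℝ) :
    volume {y | q y ≤ 1 ∧ |⟪ξ, y⟫| ≤ δ} =
      ∫⁻ t in Icc (-δ) δ, volume {z : perp ξ | q (z + t • ξ) ≤ 1} := by
  have hξn : ‖ξ‖ = 1 := by simpa using hξ
  have hm : MeasurableSet {y | q y ≤ 1 ∧ |⟪ξ, y⟫| ≤ δ} :=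
    (hq.isClosed_le.inter (isClosed_le (f := fun y => |⟪ξ, y⟫|) (by fun_prop)
      continuous_const)).measurableSet
  rw [← lintegral_indicator_one hm, lintegral_slice hξn (measurable_one.indicator hm),
    ← lintegral_indicator measurableSet_Icc]
  refine lintegral_congr fun t => ?_
  have h0 : ∀ z : perp ξ, ⟪ξ, (z : E n) + t • ξ⟫ = t := fun z => by
    rw [inner_add_right, Submodule.mem_orthogonal_singleton_iff_inner_right.1 z.2,
      inner_smul_right, real_inner_self_eq_norm_sq, hξn]
    simp
  have hm' : MeasurableSet {z : perp ξ | q (z + t • ξ) ≤ 1} :=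
    (isClosed_le (hq.continuous.comp (by fun_prop)) continuous_const).measurableSet
  by_cases ht : t ∈ Icc (-δ) δ
  · rw [indicator_of_mem ht, ← lintegral_indicator_one hm']
    refine lintegral_congr fun z => ?_
    simp only [indicator, mem_ofPred_eq, h0, abs_le.2 ht, and_true, Pi.one_apply]
  · rw [indicator_of_notMem ht]
    have : ∀ z : perp ξ, ({y | q y ≤ 1 ∧ |⟪ξ, y⟫| ≤ δ}.indicator 1 ((z : E n) + t • ξ) : ℝ≥0∞) = 0 := by
      intro z
      refine indicator_of_notMem (fun h => ht ?_) _
      exact abs_le.1 (by simpa [h0] using h.2)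
    simp [this]

theorem volume_slice_le (R : ℝ) (hR : {x | q x ≤ 1} ⊆ closedBall 0 R)
    {ξ : E n} (hξ : ξ ∈ unitSphere n) (t : ℝ) :
    volume {z : perp ξ | q (z + t • ξ) ≤ 1} ≤ volume (closedBall (0 : E (n - 1)) R) := by
  rw [← volume_closedBall_perp hξ]
  refine measure_mono fun z hz => ?_
  have h1 : ‖(z : E n) + t • ξ‖ ≤ R := by simpa using hR hz
  have h2 : ⟪(z : E n), t • ξ⟫ = 0 := by
    rw [inner_smul_right, Submodule.mem_orthogonal_singleton_iff_inner_left.1 z.2, mul_zero]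
  have h3 := norm_add_sq_eq_norm_sq_add_norm_sq_of_inner_eq_zero _ _ h2
  rw [mem_closedBall_zero_iff]
  refine le_trans ?_ h1
  refine le_of_sq_le_sq ?_ (norm_nonneg _)
  rw [Submodule.coe_norm]
  nlinarith [norm_nonneg (t • ξ)]

theorem continuousAt_volume_slice (hn : 2 ≤ n) (hq : IsRayGauge q)
    {ξ : E n} (hξ : ξ ∈ unitSphere n) :
    ContinuousAt (fun t : ℝ => volume {z : perp ξ | q (z + t • ξ) ≤ 1}) 0 := by
  obtain ⟨R, -, hRq⟩ := hq.exists_subset_closedBall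
  have hqr : IsRayGauge fun z : perp ξ => q z :=
    hq.comp_linear (perp ξ).subtypeL Subtype.val_injective
  have hfr := finrank_perp hξ
  have : Nontrivial (perp ξ) := Module.nontrivial_of_finrank_pos (R := ℝ) (by omega)
  have hm : ∀ t : ℝ, MeasurableSet {z : perp ξ | q (z + t • ξ) ≤ 1} := fun t =>
    (isClosed_le (hq.continuous.comp (by fun_prop)) continuous_const).measurableSet
  refine tendsto_measure_of_ae_tendsto_indicator (B := closedBall 0 (R + 1)) _ (hm 0) hm
    measurableSet_closedBall (isCompact_closedBall _ _).measure_lt_top.ne ?_ ?_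
  · filter_upwards [Metric.ball_mem_nhds (0 : ℝ) one_pos] with t ht z hz
    have h1 : ‖(z : E n) + t • ξ‖ ≤ R := by simpa using hRq hz
    have h2 : ‖t • ξ‖ ≤ 1 := by
      rw [norm_smul, show ‖ξ‖ = 1 by simpa using hξ, mul_one]
      exact (by simpa using ht : |t| < 1).le
    rw [mem_closedBall_zero_iff, Submodule.coe_norm]
    calc ‖(z : E n)‖ = ‖((z : E n) + t • ξ) - t • ξ‖ := by simp
      _ ≤ _ := (norm_sub_le _ _).trans (add_le_add h1 h2)
  · have hnull : ∀ᵐ z : perp ξ, q z ≠ 1 := by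
      have := hqr.volume_eq_one
      rwa [measure_eq_zero_iff_ae_notMem] at this
    filter_upwards [hnull] with z hz
    have hlim : Tendsto (fun t : ℝ => q (z + t • ξ)) (𝓝 0) (𝓝 (q z)) := by
      have := (hq.continuous.comp (show Continuous fun t : ℝ => (z : E n) + t • ξ by fun_prop)).tendsto 0
      simpa [Function.comp_def] using this
    simp only [zero_smul, add_zero]
    rcases lt_or_gt_of_ne hz with h | h
    · filter_upwards [hlim.eventually (gt_mem_nhds h)] with t ht
      exact ⟨fun _ => h.le, fun _ => ht.le⟩
    · filter_upwards [hlim.eventually (lt_mem_nhds h)] with t ht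
      exact ⟨fun h' => absurd h' ht.not_ge, fun h' => absurd h' h.not_ge⟩

theorem ofReal_inv_mul_volume_Icc {δ : ℝ} (hδ : 0 < δ) :
    ENNReal.ofReal (2 * δ)⁻¹ * volume (Icc (-δ) δ) = 1 := by
  rw [Real.volume_Icc, ← ENNReal.ofReal_mul (by positivity), ← ENNReal.ofReal_one]
  congr 1
  field_simp
  ring

/-- Averages over shrinking symmetric intervals converge to the value at the centre. -/
theorem tendsto_average_Icc {a : ℝ → ℝ≥0∞} (ha : ContinuousAt a 0) :
    Tendsto (fun δ : ℝ => ENNReal.ofReal (2 * δ)⁻¹ * ∫⁻ t in Icc (-δ) δ, a t)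
      (𝓝[>] 0) (𝓝 (a 0)) := by
  have hnear : ∀ s ∈ 𝓝 (a 0), ∀ᶠ δ in 𝓝[>] (0 : ℝ), ∀ t ∈ Icc (-δ) δ, a t ∈ s := by
    intro s hs
    obtain ⟨ε, hε, h⟩ := Metric.eventually_nhds_iff.1 (ha.eventually hs)
    filter_upwards [Ioo_mem_nhdsGT hε] with δ hδ t ht
    exact h (by rw [Real.dist_eq, sub_zero]; exact (abs_le.2 ht).trans_lt hδ.2)
  have hconst : ∀ δ : ℝ, 0 < δ → ∀ c : ℝ≥0∞,
      ENNReal.ofReal (2 * δ)⁻¹ * ∫⁻ _ in Icc (-δ) δ, c = c := by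
    intro δ hδ c
    rw [setLIntegral_const, mul_left_comm, ofReal_inv_mul_volume_Icc hδ, mul_one]
  refine tendsto_order.2 ⟨fun b hb => ?_, fun b hb => ?_⟩
  · obtain ⟨c, hbc, hc⟩ := exists_between hb
    filter_upwards [hnear _ (lt_mem_nhds hc), self_mem_nhdsWithin] with δ hδ hδ0
    refine hbc.trans_le ?_
    rw [← hconst δ hδ0 c]
    gcongr 1
    exact setLIntegral_mono' measurableSet_Icc fun t ht => (hδ t ht).le
  · obtain ⟨c, hc, hcb⟩ := exists_between hb
    filter_upwards [hnear _ (gt_mem_nhds hc), self_mem_nhdsWithin] with δ hδ hδ0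
    refine lt_of_le_of_lt ?_ hcb
    rw [← hconst δ hδ0 c]
    gcongr 1
    exact setLIntegral_mono' measurableSet_Icc fun t ht => (hδ t ht).le

/-- The measure of the pairs `(x, y)` of points of two star bodies with `|⟨x, y⟩| ≤ ε`, divided by
`2 ε`. It is symmetric in the two bodies. -/
noncomputable def orthogonalPairs (p q : E n → ℝ) (ε : ℝ) : ℝ≥0∞ :=
  ENNReal.ofReal (2 * ε)⁻¹ *
    (volume.prod volume : Measure (E n × E n)) {z | p z.1 ≤ 1 ∧ q z.2 ≤ 1 ∧ |⟪z.1, z.2⟫| ≤ ε}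

theorem orthogonalPairs_comm (hp : IsRayGauge p) (hq : IsRayGauge q) (ε : ℝ) :
    orthogonalPairs p q ε = orthogonalPairs q p ε := by
  have hm : MeasurableSet {z : E n × E n | q z.1 ≤ 1 ∧ p z.2 ≤ 1 ∧ |⟪z.1, z.2⟫| ≤ ε} :=
    ((isClosed_le (hq.continuous.comp continuous_fst) continuous_const).inter
      ((isClosed_le (hp.continuous.comp continuous_snd) continuous_const).inter
        (isClosed_le (f := fun z : E n × E n => |⟪z.1, z.2⟫|) (by fun_prop)
          continuous_const))).measurableSet
  have := (Measure.measurePreserving_swap (μ := (volume : Measure (E n)))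
    (ν := (volume : Measure (E n)))).measure_preimage hm.nullMeasurableSet
  rw [orthogonalPairs, orthogonalPairs, ← this]
  congr 2
  ext z
  simp only [mem_ofPred_eq, mem_preimage, Prod.fst_swap, Prod.snd_swap, real_inner_comm z.1 z.2]
  tauto

/-- Polar coordinates for the body `{p ≤ 1}`, for integrands homogeneous of degree `-1`. -/
theorem lintegral_cone (hn : 2 ≤ n) (hp : IsRayGauge p) {A : sphere (0 : E n) 1 → ℝ≥0∞}
    (hA : Measurable A) :
    ∫⁻ w : sphere (0 : E n) 1 × Ioi (0 : ℝ), {x | p x ≤ 1}.indicator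
        (fun _ => ENNReal.ofReal (w.2 : ℝ)⁻¹ * A w.1) ((w.2 : ℝ) • (w.1 : E n))
      ∂((volume : Measure (E n)).toSphere.prod (Measure.volumeIoiPow (n - 1))) =
    ∫⁻ ξ : sphere (0 : E n) 1, ENNReal.ofReal ((p ξ)⁻¹ ^ (n - 1) / (n - 1 : ℕ)) * A ξ
      ∂(volume : Measure (E n)).toSphere := by
  have hms : MeasurableSet {x | p x ≤ 1} := hp.isClosed_le.measurableSet
  rw [lintegral_prod]
  · refine lintegral_congr fun ξ => ?_
    have hξ := hp.pos_sphere ξ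
    have hm : Measurable fun r : ℝ => {x | p x ≤ 1}.indicator
        (fun _ => ENNReal.ofReal r⁻¹ * A ξ) (r • (ξ : E n)) := by
      refine Measurable.ite ?_ (by fun_prop) measurable_const
      exact hms.preimage (by fun_prop)
    rw [lintegral_volumeIoiPow _ hm]
    have h1 : ∀ r ∈ Ioi (0 : ℝ), ENNReal.ofReal (r ^ (n - 1)) *
        {x | p x ≤ 1}.indicator (fun _ => ENNReal.ofReal r⁻¹ * A ξ) (r • (ξ : E n)) =
        (Iic (p ξ)⁻¹).indicator (fun r => ENNReal.ofReal (r ^ (n - 2)) * A ξ) r := by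
      intro r hr
      have hr' : 0 < r := hr
      have h2 : ENNReal.ofReal (r ^ (n - 1)) * ENNReal.ofReal r⁻¹ = ENNReal.ofReal (r ^ (n - 2)) := by
        rw [← ENNReal.ofReal_mul (by positivity), show n - 1 = (n - 2) + 1 by omega, pow_succ,
          mul_assoc, mul_inv_cancel₀ hr'.ne', mul_one]
      by_cases h : r ≤ (p ξ)⁻¹
      · rw [indicator_of_mem (show r • (ξ : E n) ∈ {x | p x ≤ 1} from
          (hp.smul_le_one_iff ξ hr').2 h), indicator_of_mem (show r ∈ Iic (p ξ)⁻¹ from h),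
          ← mul_assoc, h2]
      · rw [indicator_of_notMem (show r • (ξ : E n) ∉ {x | p x ≤ 1} from
          fun h' => h ((hp.smul_le_one_iff ξ hr').1 h')),
          indicator_of_notMem (show r ∉ Iic (p ξ)⁻¹ from h), mul_zero]
    rw [setLIntegral_congr_fun measurableSet_Ioi h1, setLIntegral_indicator measurableSet_Iic,
      Iic_inter_Ioi, lintegral_mul_const _ (by fun_prop),
      IsRayGauge.lintegral_Ioc_pow _ (by positivity)]
    congr 3
    · congr 1; omega
    · rw [show n - 1 = (n - 2) + 1 by omega]; push_cast; ring
  · refine (Measurable.ite ?_ (by fun_prop) measurable_const).aemeasurable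
    exact hms.preimage (by fun_prop)

theorem measurable_volume_section (hn : 2 ≤ n) (hq : IsRayGauge q) :
    Measurable fun ξ : sphere (0 : E n) 1 => volume {z : perp (ξ : E n) | q z ≤ 1} :=
  (continuousOn_iff_continuous_domRestrict.1 (continuousOn_volume_section hn hq)).measurable

/-- For fixed `x = r ξ`, the points `y` of `{q ≤ 1}` with `|⟨x, y⟩| ≤ ε` form a slab of half-width
`ε / r` around `ξ^⊥`. Its volume divided by `2 ε` tends to `r⁻¹` times the volume of the section by
`ξ^⊥`; polar coordinates in `x` give the limit of the measure of pairs. -/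
theorem tendsto_orthogonalPairs (hn : 2 ≤ n) (hp : IsRayGauge p) (hq : IsRayGauge q) :
    Tendsto (orthogonalPairs p q) (𝓝[>] 0)
      (𝓝 (∫⁻ ξ : sphere (0 : E n) 1, ENNReal.ofReal ((p ξ)⁻¹ ^ (n - 1) / (n - 1 : ℕ)) *
        volume {z : perp (ξ : E n) | q z ≤ 1} ∂(volume : Measure (E n)).toSphere)) := by
  obtain ⟨R, -, hRq⟩ := hq.exists_subset_closedBall
  have : Nontrivial (E n) := Module.nontrivial_of_finrank_pos (R := ℝ) (by simp; omega)
  have hmset : ∀ ε : ℝ, MeasurableSet {z : E n × E n | q z.2 ≤ 1 ∧ |⟪z.1, z.2⟫| ≤ ε} := fun ε =>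
    ((isClosed_le (hq.continuous.comp continuous_snd) continuous_const).inter
        (isClosed_le (f := fun z : E n × E n => |⟪z.1, z.2⟫|) (by fun_prop)
          continuous_const)).measurableSet
  have hmset' : ∀ ε : ℝ, MeasurableSet
      {z : E n × E n | p z.1 ≤ 1 ∧ q z.2 ≤ 1 ∧ |⟪z.1, z.2⟫| ≤ ε} := fun ε =>
    (isClosed_le (hp.continuous.comp continuous_fst) continuous_const).measurableSet.inter (hmset ε)
  let F : ℝ → E n → ℝ≥0∞ := fun ε => {x | p x ≤ 1}.indicator fun x =>
    ENNReal.ofReal (2 * ε)⁻¹ * volume {y | q y ≤ 1 ∧ |⟪x, y⟫| ≤ ε}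
  have hFm : ∀ ε, Measurable (F ε) := fun ε =>
    ((measurable_measure_prodMk_left (hmset ε)).const_mul _).indicator hp.isClosed_le.measurableSet
  have hD : ∀ ε, orthogonalPairs p q ε =
      ∫⁻ w : sphere (0 : E n) 1 × Ioi (0 : ℝ), F ε ((w.2 : ℝ) • (w.1 : E n))
        ∂((volume : Measure (E n)).toSphere.prod (Measure.volumeIoiPow (n - 1))) := by
    intro ε
    have h := lintegral_polar_prod (hFm ε)
    rw [finrank_euclideanSpace_fin] at h
    rw [← h, orthogonalPairs, Measure.prod_apply (hmset' ε), ← lintegral_const_mul _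
      (measurable_measure_prodMk_left (hmset' ε))]
    refine lintegral_congr fun x => ?_
    by_cases hx : p x ≤ 1
    · simp only [F]
      rw [indicator_of_mem (show x ∈ {x | p x ≤ 1} from hx)]
      simp [preimage, hx]
    · simp only [F]
      rw [indicator_of_notMem (show x ∉ {x | p x ≤ 1} from hx)]
      simp [preimage, hx]
  have hF : ∀ ε : ℝ, 0 < ε → ∀ w : sphere (0 : E n) 1 × Ioi (0 : ℝ),
      F ε ((w.2 : ℝ) • (w.1 : E n)) = {x | p x ≤ 1}.indicator (fun _ =>
        ENNReal.ofReal (w.2 : ℝ)⁻¹ * (ENNReal.ofReal (2 * (ε / w.2))⁻¹ *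
          ∫⁻ t in Icc (-(ε / (w.2 : ℝ))) (ε / w.2),
            volume {z : perp (w.1 : E n) | q (z + t • (w.1 : E n)) ≤ 1}))
        ((w.2 : ℝ) • (w.1 : E n)) := by
    rintro ε hε ⟨ξ, r, hr⟩
    have hr' : 0 < r := hr
    simp only [F, indicator]
    split_ifs with h
    · rw [← volume_slab hq ξ.2, ← mul_assoc, ← ENNReal.ofReal_mul (by positivity)]
      congr 2
      · field_simp
      · ext y
        simp only [mem_ofPred_eq, real_inner_smul_left, abs_mul, abs_of_pos hr', le_div_iff₀' hr']
    · rfl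
  simp only [funext hD]
  rw [← lintegral_cone hn hp (measurable_volume_section hn hq)]
  refine tendsto_lintegral_filter_of_dominated_convergence
    (fun w => {x | p x ≤ 1}.indicator (fun _ => ENNReal.ofReal (w.2 : ℝ)⁻¹ *
      volume (closedBall (0 : E (n - 1)) R)) ((w.2 : ℝ) • (w.1 : E n))) ?_ ?_ ?_ ?_
  · exact .of_forall fun ε => (hFm ε).comp (by fun_prop)
  · filter_upwards [self_mem_nhdsWithin] with ε hε
    refine .of_forall fun w => ?_
    have hδ : 0 < ε / (w.2 : ℝ) := div_pos hε (mem_Ioi.1 w.2.2)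
    rw [hF ε hε]
    refine indicator_le_indicator ?_
    gcongr 1
    calc _ ≤ ENNReal.ofReal (2 * (ε / w.2))⁻¹ * ∫⁻ t in Icc (-(ε / (w.2 : ℝ))) (ε / w.2),
          volume (closedBall (0 : E (n - 1)) R) := by
          gcongr 1
          exact lintegral_mono fun t => volume_slice_le R hRq w.1.2 t
      _ = _ := by
        rw [setLIntegral_const, mul_left_comm, ofReal_inv_mul_volume_Icc hδ, mul_one]
  · rw [lintegral_cone hn hp measurable_const, lintegral_mul_const']
    · refine ENNReal.mul_ne_top ?_ (isCompact_closedBall _ _).measure_lt_top.ne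
      exact ((hp.integrable_sphere (n - 1)).div_const _).lintegral_lt_top.ne
    · exact (isCompact_closedBall _ _).measure_lt_top.ne
  · refine .of_forall fun w => ?_
    have h1 : Tendsto (fun ε : ℝ => ε / (w.2 : ℝ)) (𝓝[>] 0) (𝓝[>] 0) := by
      refine tendsto_nhdsWithin_iff.2 ⟨?_, ?_⟩
      · have : Tendsto (fun ε : ℝ => ε / (w.2 : ℝ)) (𝓝 0) (𝓝 (0 / (w.2 : ℝ))) :=
          tendsto_id.div_const _
        rw [zero_div] at this
        exact this.mono_left nhdsWithin_le_nhds
      · filter_upwards [self_mem_nhdsWithin] with ε hε using div_pos hε (mem_Ioi.1 w.2.2)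
    have h2 := (tendsto_average_Icc (continuousAt_volume_slice hn hq w.1.2)).comp h1
    simp only [zero_smul, add_zero] at h2
    refine Tendsto.congr' (f₁ := fun ε => {x | p x ≤ 1}.indicator (fun _ =>
        ENNReal.ofReal (w.2 : ℝ)⁻¹ * (ENNReal.ofReal (2 * (ε / w.2))⁻¹ *
          ∫⁻ t in Icc (-(ε / (w.2 : ℝ))) (ε / w.2),
            volume {z : perp (w.1 : E n) | q (z + t • (w.1 : E n)) ≤ 1}))
        ((w.2 : ℝ) • (w.1 : E n))) ?_ ?_
    · filter_upwards [self_mem_nhdsWithin] with ε hε using (hF ε hε w).symm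
    · simp only [indicator]
      split_ifs
      · exact ENNReal.Tendsto.const_mul h2 (Or.inr ENNReal.ofReal_ne_top)
      · exact tendsto_const_nhds

/-- Self-adjointness of the spherical Radon transform, for powers of radial functions: integrating
the section function of one star body against `ρ^{n-1}` of another is symmetric in the two. -/
theorem integral_pow_mul_sectionVol_comm (hn : 2 ≤ n) (hp : IsRayGauge p) (hq : IsRayGauge q) :
    ∫ ξ : sphere (0 : E n) 1, (p ξ)⁻¹ ^ (n - 1) * sectionVol {x | q x ≤ 1} ξ
      ∂(volume : Measure (E n)).toSphere =
    ∫ ξ : sphere (0 : E n) 1, (q ξ)⁻¹ ^ (n - 1) * sectionVol {x | p x ≤ 1} ξ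
      ∂(volume : Measure (E n)).toSphere := by
  have h1 := tendsto_orthogonalPairs hn hp hq
  have h2 := tendsto_orthogonalPairs hn hq hp
  rw [show orthogonalPairs p q = orthogonalPairs q p from funext (orthogonalPairs_comm hp hq)] at h1
  have h3 := tendsto_nhds_unique h1 h2
  have hn1 : (0 : ℝ) < (n - 1 : ℕ) := by exact_mod_cast (by omega : 0 < n - 1)
  have key : ∀ {p q : E n → ℝ}, IsRayGauge p → IsRayGauge q →
      ∫ ξ : sphere (0 : E n) 1, (p ξ)⁻¹ ^ (n - 1) * sectionVol {x | q x ≤ 1} ξ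
        ∂(volume : Measure (E n)).toSphere = (n - 1 : ℕ) *
      (∫⁻ ξ : sphere (0 : E n) 1, ENNReal.ofReal ((p ξ)⁻¹ ^ (n - 1) / (n - 1 : ℕ)) *
        volume {z : perp (ξ : E n) | q z ≤ 1} ∂(volume : Measure (E n)).toSphere).toReal := by
    intro p q hp hq
    rw [← integral_toReal, ← integral_const_mul]
    · refine integral_congr_ae (.of_forall fun ξ => ?_)
      have := hp.pos_sphere ξ
      simp only [ENNReal.toReal_mul]
      rw [ENNReal.toReal_ofReal (by positivity), ← mul_assoc, mul_div_cancel₀ _ hn1.ne']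
      rfl
    · have hpm := hp.continuous.measurable
      exact (Measurable.mul (by fun_prop) (measurable_volume_section hn hq)).aemeasurable
    · refine .of_forall fun ξ => ENNReal.mul_lt_top ENNReal.ofReal_lt_top ?_
      exact (hq.comp_linear (perp (ξ : E n)).subtypeL Subtype.val_injective).volume_le_lt_top
  rw [key hp hq, key hq hp, h3]

end Duality

/-! ### Volume inequalities for intersection bodies -/

section VolumeInequality

variable {n : ℕ} {p q : E n → ℝ} {K L : Set (E n)}

theorem vol_closedBall_pos (m : ℕ) : 0 < vol (closedBall (0 : E m) 1) := by
  rw [vol, measureReal_def]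
  exact ENNReal.toReal_pos (measure_closedBall_pos _ _ one_pos).ne'
    (isCompact_closedBall _ _).measure_lt_top.ne

theorem sectionConst_pos (n : ℕ) : 0 < sectionConst n :=
  div_pos (Real.rpow_pos_of_pos (vol_closedBall_pos n) _) (vol_closedBall_pos _)

theorem setOf_norm_le_one : {x : E n | ‖x‖ ≤ 1} = closedBall 0 1 := by
  ext; simp

theorem sectionVol_closedBall {ξ : E n} (hξ : ξ ∈ unitSphere n) :
    sectionVol (closedBall (0 : E n) 1) ξ = vol (closedBall (0 : E (n - 1)) 1) := by
  rw [vol, measureReal_def, ← volume_closedBall_perp hξ, sectionVol, measureReal_def]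
  congr 2

theorem IsIntersectionBodyOf.radial_eq_sectionVol {M : Set (E n)} (h : IsIntersectionBodyOf K M)
    {ξ : E n} (hξ : ξ ∈ unitSphere n) : radial K ξ = sectionVol {x | gauge M x ≤ 1} ξ := by
  rw [h.radial_eq ξ hξ, h.isStarBody_right.setOf_gauge_le_one]

theorem integrable_pow_mul (hp : IsRayGauge p) (m : ℕ) {f : E n → ℝ}
    (hf : ContinuousOn f (unitSphere n)) :
    Integrable (fun ξ : sphere (0 : E n) 1 => (p ξ)⁻¹ ^ m * f ξ) (volume : Measure (E n)).toSphere := by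
  have h1 : Continuous fun ξ : sphere (0 : E n) 1 => f ξ :=
    continuousOn_iff_continuous_domRestrict.1 hf
  have h2 : Continuous fun ξ : sphere (0 : E n) 1 => (p ξ)⁻¹ ^ m :=
    ((hp.continuous.comp continuous_subtype_val).inv₀ fun ξ => (hp.pos_sphere ξ).ne').pow m
  exact (h2.mul h1).integrable_of_hasCompactSupport (.of_compactSpace _)

theorem IsRayGauge.continuousOn_inv (hp : IsRayGauge p) :
    ContinuousOn (fun ξ => (p ξ)⁻¹) (unitSphere n) :=
  hp.continuous.continuousOn.inv₀ fun ξ hξ => (hp.pos_sphere ⟨ξ, hξ⟩).ne'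

/-- The comparison of sections, integrated against the radial function of an intersection body of a
star body. The last term comes from duality with the Euclidean ball, whose sections are constant. -/
theorem IsIntersectionBodyOf.integral_le (hn : 2 ≤ n) {I M : Set (E n)}
    (hI : IsIntersectionBodyOf I M) (hp : IsRayGauge p) (hq : IsRayGauge q) {T : ℝ}
    (hT : ∀ ξ ∈ unitSphere n, sectionVol {x | p x ≤ 1} ξ - sectionVol {x | q x ≤ 1} ξ ≤ T) :
    ∫ ξ : sphere (0 : E n) 1, (p ξ)⁻¹ ^ (n - 1) * radial I ξ ∂(volume : Measure (E n)).toSphere ≤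
      ∫ ξ : sphere (0 : E n) 1, (q ξ)⁻¹ ^ (n - 1) * radial I ξ ∂(volume : Measure (E n)).toSphere
      + T / vol (closedBall (0 : E (n - 1)) 1) *
        ∫ ξ : sphere (0 : E n) 1, radial I ξ ∂(volume : Measure (E n)).toSphere := by
  have hκ := vol_closedBall_pos (n - 1)
  have hm := hI.isStarBody_right.isRayGauge
  have hrad : ∀ ξ : sphere (0 : E n) 1, radial I ξ = sectionVol {x | gauge M x ≤ 1} ξ :=
    fun ξ => hI.radial_eq_sectionVol ξ.2
  have hball : ∫ ξ : sphere (0 : E n) 1, radial I ξ ∂(volume : Measure (E n)).toSphere =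
      vol (closedBall (0 : E (n - 1)) 1) * ∫ ξ : sphere (0 : E n) 1, (gauge M ξ)⁻¹ ^ (n - 1)
        ∂(volume : Measure (E n)).toSphere := by
    have h := integral_pow_mul_sectionVol_comm hn IsRayGauge.norm hm
    rw [setOf_norm_le_one] at h
    simp only [sectionVol_closedBall (Subtype.prop _), norm_eq_of_mem_sphere, inv_one, one_pow,
      one_mul] at h
    simp only [hrad, h]
    rw [integral_mul_const, mul_comm]
  rw [hball, ← mul_assoc, div_mul_cancel₀ _ hκ.ne']
  simp only [hrad]
  rw [integral_pow_mul_sectionVol_comm hn hp hm, integral_pow_mul_sectionVol_comm hn hq hm,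
    ← integral_const_mul, ← integral_add (integrable_pow_mul hm _ (continuousOn_sectionVol hn hq))
      ((hm.integrable_sphere _).const_mul _)]
  refine integral_mono (integrable_pow_mul hm _ (continuousOn_sectionVol hn hp))
    ((integrable_pow_mul hm _ (continuousOn_sectionVol hn hq)).add
      ((hm.integrable_sphere _).const_mul _)) fun ξ => ?_
  have h1 : 0 ≤ (gauge M ξ)⁻¹ ^ (n - 1) := pow_nonneg (inv_nonneg.2 (gauge_nonneg _)) _
  have h2 := mul_le_mul_of_nonneg_left (hT ξ ξ.2) h1
  simp only
  linarith

/-- The same inequality for all intersection bodies, by approximation in the radial metric. -/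
theorem IsIntersectionBody.integral_le (hn : 2 ≤ n) (hK : IsIntersectionBody K)
    (hp : IsRayGauge p) (hq : IsRayGauge q) {T : ℝ}
    (hT : ∀ ξ ∈ unitSphere n, sectionVol {x | p x ≤ 1} ξ - sectionVol {x | q x ≤ 1} ξ ≤ T) :
    ∫ ξ : sphere (0 : E n) 1, (p ξ)⁻¹ ^ (n - 1) * radial K ξ ∂(volume : Measure (E n)).toSphere ≤
      ∫ ξ : sphere (0 : E n) 1, (q ξ)⁻¹ ^ (n - 1) * radial K ξ ∂(volume : Measure (E n)).toSphere
      + T / vol (closedBall (0 : E (n - 1)) 1) *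
        ∫ ξ : sphere (0 : E n) 1, radial K ξ ∂(volume : Measure (E n)).toSphere := by
  set σ := (volume : Measure (E n)).toSphere
  set τ := T / vol (closedBall (0 : E (n - 1)) 1)
  have hKc : ContinuousOn (radial K) (unitSphere n) := hK.isStarBody.isRayGauge.continuousOn_inv
  have happrox : ∀ {f : E n → ℝ}, IsRayGauge f → ∀ m : ℕ, ∀ {I : Set (E n)} {ε : ℝ}, IsStarBody I →
      (∀ ξ ∈ unitSphere n, |radial K ξ - radial I ξ| ≤ ε) →
      |∫ ξ : sphere (0 : E n) 1, (f ξ)⁻¹ ^ m * radial K ξ ∂σ -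
        ∫ ξ : sphere (0 : E n) 1, (f ξ)⁻¹ ^ m * radial I ξ ∂σ| ≤
        ε * ∫ ξ : sphere (0 : E n) 1, (f ξ)⁻¹ ^ m ∂σ := by
    intro f hf m I ε hI hε
    have hIc : ContinuousOn (radial I) (unitSphere n) := hI.isRayGauge.continuousOn_inv
    rw [← integral_sub (integrable_pow_mul hf m hKc) (integrable_pow_mul hf m hIc),
      ← integral_const_mul, ← Real.norm_eq_abs]
    refine norm_integral_le_of_norm_le ((hf.integrable_sphere m).const_mul ε)
      (.of_forall fun ξ => ?_)
    have h1 : 0 ≤ (f ξ)⁻¹ ^ m := pow_nonneg (inv_nonneg.2 (hf.nonneg _)) _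
    rw [← mul_sub, norm_mul, Real.norm_of_nonneg h1, Real.norm_eq_abs, mul_comm]
    exact mul_le_mul_of_nonneg_right (hε ξ ξ.2) h1
  set C := ∫ ξ : sphere (0 : E n) 1, (p ξ)⁻¹ ^ (n - 1) ∂σ +
    ∫ ξ : sphere (0 : E n) 1, (q ξ)⁻¹ ^ (n - 1) ∂σ +
    |τ| * ∫ ξ : sphere (0 : E n) 1, ‖(ξ : E n)‖⁻¹ ^ 0 ∂σ
  have hstep : ∀ ε : ℝ, 0 < ε →
      ∫ ξ : sphere (0 : E n) 1, (p ξ)⁻¹ ^ (n - 1) * radial K ξ ∂σ ≤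
      (∫ ξ : sphere (0 : E n) 1, (q ξ)⁻¹ ^ (n - 1) * radial K ξ ∂σ
      + τ * ∫ ξ : sphere (0 : E n) 1, radial K ξ ∂σ) + ε * C := by
    intro ε hε
    obtain ⟨I, M, hI, hclose⟩ := hK.mem_closure ε hε
    have h0 := hI.integral_le hn hp hq hT
    have h1 := (abs_le.1 (happrox hp (n - 1) hI.isStarBody_left hclose)).2
    have h2 := (abs_le.1 (happrox hq (n - 1) hI.isStarBody_left hclose)).1
    have h3 := happrox (IsRayGauge.norm (V := E n)) 0 hI.isStarBody_left hclose
    simp only [pow_zero, one_mul] at h3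
    have h4 : |τ| * |∫ ξ : sphere (0 : E n) 1, radial K ξ ∂σ -
        ∫ ξ : sphere (0 : E n) 1, radial I ξ ∂σ| ≤ |τ| * (ε * ∫ ξ : sphere (0 : E n) 1, 1 ∂σ) :=
      mul_le_mul_of_nonneg_left h3 (abs_nonneg _)
    rw [← abs_mul] at h4
    have h5 := (abs_le.1 h4).1
    simp only [C, pow_zero]
    change _ ≤ _ + τ * _ at h0
    linarith
  refine le_of_forall_pos_le_add fun δ hδ => ?_
  have hC : 0 ≤ C := by
    refine add_nonneg (add_nonneg ?_ ?_) (mul_nonneg (abs_nonneg _) ?_)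
    · exact integral_nonneg fun ξ => pow_nonneg (inv_nonneg.2 (hp.nonneg _)) _
    · exact integral_nonneg fun ξ => pow_nonneg (inv_nonneg.2 (hq.nonneg _)) _
    · exact integral_nonneg fun ξ => by positivity
  refine (hstep (δ / (C + 1)) (by positivity)).trans ?_
  gcongr
  rw [div_mul_eq_mul_div, div_le_iff₀ (by positivity)]
  nlinarith

/-- Hölder's inequality for dual mixed volumes. -/
theorem integral_pow_mul_inv_le (hn : 2 ≤ n) (hp : IsRayGauge p) (hq : IsRayGauge q) :
    ∫ ξ : sphere (0 : E n) 1, (q ξ)⁻¹ ^ (n - 1) * (p ξ)⁻¹ ∂(volume : Measure (E n)).toSphere ≤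
      (n * vol {x | q x ≤ 1}) ^ (((n : ℝ) - 1) / n) * (n * vol {x | p x ≤ 1}) ^ (1 / (n : ℝ)) := by
  have hn0 : (0 : ℝ) < n := by positivity
  have hn1 : (0 : ℝ) < (n : ℝ) - 1 := by
    have : (2 : ℝ) ≤ n := by exact_mod_cast hn
    linarith
  have : Nontrivial (E n) := Module.nontrivial_of_finrank_pos (R := ℝ) (by simp; omega)
  have hvol : ∀ {f : E n → ℝ}, IsRayGauge f → n * vol {x | f x ≤ 1} =
      ∫ ξ : sphere (0 : E n) 1, (f ξ)⁻¹ ^ n ∂(volume : Measure (E n)).toSphere := by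
    intro f hf
    rw [vol, hf.real_volume_le_one, finrank_euclideanSpace_fin, mul_div_cancel₀ _ hn0.ne']
  have hconj : ((n : ℝ) / (n - 1)).HolderConjugate n := by
    rw [Real.holderConjugate_iff]
    constructor
    · rw [lt_div_iff₀ hn1]; linarith
    · field_simp; ring
  have hmem : ∀ {f : E n → ℝ}, IsRayGauge f → ∀ (m : ℕ) (r : ℝ≥0∞),
      MemLp (fun ξ : sphere (0 : E n) 1 => (f ξ)⁻¹ ^ m) r (volume : Measure (E n)).toSphere := by
    intro f hf m r
    have h2 : Continuous fun ξ : sphere (0 : E n) 1 => (f ξ)⁻¹ ^ m :=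
      ((hf.continuous.comp continuous_subtype_val).inv₀ fun ξ => (hf.pos_sphere ξ).ne').pow m
    obtain ⟨C, hC⟩ := (isCompact_univ (X := sphere (0 : E n) 1)).exists_bound_of_continuousOn
      h2.continuousOn
    exact MemLp.of_bound h2.aestronglyMeasurable C (.of_forall fun ξ => hC ξ (mem_univ _))
  have h := integral_mul_le_Lp_mul_Lq_of_nonneg hconj
    (μ := (volume : Measure (E n)).toSphere)
    (f := fun ξ : sphere (0 : E n) 1 => (q ξ)⁻¹ ^ (n - 1)) (g := fun ξ => (p ξ)⁻¹)
    (.of_forall fun ξ => pow_nonneg (inv_nonneg.2 (hq.nonneg _)) _)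
    (.of_forall fun ξ => inv_nonneg.2 (hp.nonneg _)) (hmem hq _ _)
    (by simpa using hmem hp 1 (ENNReal.ofReal n))
  refine h.trans_eq ?_
  rw [hvol hq, hvol hp]
  congr 2
  · refine integral_congr_ae (.of_forall fun ξ => ?_)
    have := hq.pos_sphere ξ
    simp only
    rw [← Real.rpow_natCast, ← Real.rpow_mul (by positivity), ← Real.rpow_natCast _ n]
    congr 1
    rw [Nat.cast_sub (by omega), Nat.cast_one]
    field_simp
  · rw [one_div_div]
  · simp only [Real.rpow_natCast]

/-- Comparing sections compares volumes, when the first body is an intersection body. -/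
theorem IsIntersectionBody.vol_rpow_le (hn : 2 ≤ n) (hK : IsIntersectionBody K)
    (hL : IsStarBody L) {T : ℝ} (hT0 : 0 ≤ T)
    (hT : ∀ ξ ∈ unitSphere n, sectionVol K ξ - sectionVol L ξ ≤ T) :
    vol K ^ (((n : ℝ) - 1) / n) ≤ vol L ^ (((n : ℝ) - 1) / n) + sectionConst n * T := by
  have hn0 : (0 : ℝ) < n := by positivity
  have : Nontrivial (E n) := Module.nontrivial_of_finrank_pos (R := ℝ) (by simp; omega)
  have hκ := vol_closedBall_pos (n - 1)
  have hp := hK.isStarBody.isRayGauge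
  have hq := hL.isRayGauge
  have hKeq := hK.isStarBody.setOf_gauge_le_one
  have hLeq := hL.setOf_gauge_le_one
  have h1 := hK.integral_le hn hp hq (T := T) (by rwa [hKeq, hLeq])
  have h2 := integral_pow_mul_inv_le hn hp hq
  have h3 := integral_pow_mul_inv_le hn hp (IsRayGauge.norm (V := E n))
  simp only [norm_eq_of_mem_sphere, inv_one, one_pow, one_mul, setOf_norm_le_one] at h3
  rw [hKeq] at h2 h3
  rw [hLeq] at h2
  have h0 : ∫ ξ : sphere (0 : E n) 1, (gauge K ξ)⁻¹ ^ (n - 1) * radial K ξ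
      ∂(volume : Measure (E n)).toSphere = n * vol K := by
    have h := hp.real_volume_le_one
    rw [hKeq, finrank_euclideanSpace_fin] at h
    rw [vol, h, mul_div_cancel₀ _ hn0.ne']
    refine integral_congr_ae (.of_forall fun ξ => ?_)
    change (gauge K ξ)⁻¹ ^ (n - 1) * (gauge K ξ)⁻¹ = _
    rw [← pow_succ, Nat.sub_add_cancel (by omega)]
  have hvK : 0 < vol K := by
    rw [vol, measureReal_def]
    exact ENNReal.toReal_pos
      (Measure.measure_pos_of_mem_nhds _ (mem_interior_iff_mem_nhds.1 hK.isStarBody.zero_mem_interior)).ne'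
      hK.isStarBody.isBounded.measure_lt_top.ne
  have hvL : 0 ≤ vol L := measureReal_nonneg
  have hω := vol_closedBall_pos n
  rw [h0] at h1
  set a := ((n : ℝ) - 1) / n with ha
  set X := (n * vol K) ^ (1 / (n : ℝ)) with hX
  have hXpos : 0 < X := by positivity
  have hsplit : n * vol K = (n * vol K) ^ a * X := by
    rw [hX, ← Real.rpow_add (by positivity), ha, ← add_div, sub_add_cancel, div_self hn0.ne',
      Real.rpow_one]
  have h4 : (n * vol K) ^ a * X ≤
      ((n * vol L) ^ a + T / vol (closedBall (0 : E (n - 1)) 1) *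
        (n * vol (closedBall (0 : E n) 1)) ^ a) * X := by
    rw [← hsplit, add_mul, mul_assoc]
    refine h1.trans (add_le_add h2 ?_)
    exact mul_le_mul_of_nonneg_left h3 (by positivity)
  have h5 := le_of_mul_le_mul_right h4 hXpos
  rw [Real.mul_rpow hn0.le hvK.le, Real.mul_rpow hn0.le hvL, Real.mul_rpow hn0.le hω.le] at h5
  have hna : (0 : ℝ) < (n : ℝ) ^ a := by positivity
  refine le_of_mul_le_mul_left (h5.trans_eq ?_) hna
  rw [sectionConst]
  ring

theorem isStarBody_closedBall {r : ℝ} (hr : 0 < r) : IsStarBody (closedBall (0 : E n) r) := by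
  have h := (IsRayGauge.norm (V := E n)).const_mul (inv_pos.2 hr)
  have h2 := h.isStarBody (by simp)
  convert h2 using 1
  ext x
  simp [inv_mul_le_iff₀ hr]

/-- The hyperplane inequality, from the comparison with balls of radius tending to zero. -/
theorem IsIntersectionBody.vol_rpow_le_of_section_le (hn : 2 ≤ n) (hK : IsIntersectionBody K)
    {T : ℝ} (hT : ∀ ξ ∈ unitSphere n, sectionVol K ξ ≤ T) (hT0 : 0 ≤ T) :
    vol K ^ (((n : ℝ) - 1) / n) ≤ sectionConst n * T := by
  have ha : 0 < ((n : ℝ) - 1) / n := by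
    have : (2 : ℝ) ≤ n := by exact_mod_cast hn
    exact div_pos (by linarith) (by linarith)
  have h1 : ∀ r : ℝ, 0 < r → vol K ^ (((n : ℝ) - 1) / n) ≤
      (r ^ n * vol (closedBall (0 : E n) 1)) ^ (((n : ℝ) - 1) / n) + sectionConst n * T := by
    intro r hr
    have h2 := hK.vol_rpow_le hn (isStarBody_closedBall hr) hT0 fun ξ hξ =>
      (sub_le_self _ measureReal_nonneg).trans (hT ξ hξ)
    have h3 : vol (closedBall (0 : E n) r) = r ^ n * vol (closedBall (0 : E n) 1) := by
      rw [vol, vol, measureReal_def, measureReal_def,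
        Measure.addHaar_closedBall' _ _ hr.le, ENNReal.toReal_mul,
        ENNReal.toReal_ofReal (by positivity), finrank_euclideanSpace_fin]
    rwa [h3] at h2
  have hlim : Tendsto (fun r : ℝ => (r ^ n * vol (closedBall (0 : E n) 1)) ^ (((n : ℝ) - 1) / n) +
      sectionConst n * T) (𝓝[>] 0) (𝓝 (0 + sectionConst n * T)) := by
    refine Tendsto.add ?_ tendsto_const_nhds
    have hc : Continuous fun r : ℝ =>
        (r ^ n * vol (closedBall (0 : E n) 1)) ^ (((n : ℝ) - 1) / n) :=
      Continuous.rpow_const (by fun_prop) fun _ => Or.inr ha.le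
    have h := hc.tendsto 0
    rw [zero_pow (by omega), zero_mul, Real.zero_rpow ha.ne'] at h
    exact h.mono_left nhdsWithin_le_nhds
  rw [zero_add] at hlim
  exact ge_of_tendsto hlim (eventually_mem_nhdsWithin.mono h1)

theorem measureReal_euclidean_zero {s : Set (E 0)} (hs : (0 : E 0) ∈ s) :
    (volume : Measure (E 0)).real s = 1 := by
  rw [measureReal_def, volume_euclideanSpace_eq_dirac, Measure.dirac_apply_of_mem hs]
  simp

theorem sectionVol_eq_one {K : Set (E 1)} (hK : (0 : E 1) ∈ K) {ξ : E 1} (hξ : ξ ∈ unitSphere 1) :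
    sectionVol K ξ = 1 := by
  obtain ⟨e⟩ := exists_isometry_perp hξ
  have hsub : Subsingleton (perp ξ) :=
    Module.finrank_zero_iff.1 (finrank_perp hξ)
  have huniv : {x : perp ξ | (x : E 1) ∈ K} = univ := by
    ext x
    simp [Subsingleton.elim x 0, hK]
  rw [sectionVol, huniv, measureReal_def,
    ← e.measurePreserving.measure_preimage MeasurableSet.univ.nullMeasurableSet, preimage_univ,
    ← measureReal_def]
  exact measureReal_euclidean_zero (mem_univ _)

theorem IsStarBody.continuousOn_sectionVol (hn : 1 ≤ n) (hK : IsStarBody K) :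
    ContinuousOn (sectionVol K) (unitSphere n) := by
  rcases hn.eq_or_lt with rfl | hn
  · exact continuousOn_const.congr fun ξ hξ =>
      sectionVol_eq_one (interior_subset hK.zero_mem_interior) hξ
  · rw [← hK.setOf_gauge_le_one]
    exact SectionStability.continuousOn_sectionVol hn hK.isRayGauge

/-- Continuous functions attain their maximum on the sphere, which is nonempty as `1 ≤ n`. -/
theorem exists_isGreatest_image (hn : 1 ≤ n) {f : E n → ℝ} (hf : ContinuousOn f (unitSphere n)) :
    ∃ M, IsGreatest (f '' unitSphere n) M := by
  have : Nontrivial (E n) := Module.nontrivial_of_finrank_pos (R := ℝ) (by simp; omega)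
  exact ((isCompact_sphere _ _).image_of_continuousOn hf).exists_isGreatest
    ((NormedSpace.sphere_nonempty.2 zero_le_one).image f)

/-- The difference of volumes is controlled by the difference of sections. In dimension one both
volumes are raised to the power `0`. -/
theorem volume_difference_inequality (hn : 1 ≤ n) (hK : IsIntersectionBody K)
    (hL : IsIntersectionBody L) :
    ∃ M : ℝ, IsGreatest ((fun ξ => |sectionVol K ξ - sectionVol L ξ|) '' unitSphere n) M ∧
      |vol K ^ (((n : ℝ) - 1) / n) - vol L ^ (((n : ℝ) - 1) / n)| ≤ sectionConst n * M := by
  obtain ⟨M, hM⟩ := exists_isGreatest_image hn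
    ((hK.isStarBody.continuousOn_sectionVol hn).sub (hL.isStarBody.continuousOn_sectionVol hn)).abs
  refine ⟨M, hM, ?_⟩
  have hle : ∀ ξ ∈ unitSphere n, |sectionVol K ξ - sectionVol L ξ| ≤ M := fun ξ hξ =>
    hM.2 ⟨ξ, hξ, rfl⟩
  have hM0 : 0 ≤ M := by
    obtain ⟨ξ, -, h⟩ := hM.1
    exact h ▸ abs_nonneg _
  rcases hn.eq_or_lt with rfl | hn
  · simpa using mul_nonneg (sectionConst_pos 1).le hM0
  · have h1 := hK.vol_rpow_le hn hL.isStarBody hM0 fun ξ hξ => (abs_le.1 (hle ξ hξ)).2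
    have h2 := hL.vol_rpow_le hn hK.isStarBody hM0 fun ξ hξ => by
      have := (abs_le.1 (hle ξ hξ)).1
      linarith
    exact abs_le.2 ⟨by linarith, by linarith⟩

/-- The hyperplane inequality. In dimension one a central section is a point, of measure `1`, and both
sides are equal to `1`. -/
theorem hyperplane_inequality (hn : 1 ≤ n) (hK : IsIntersectionBody K) :
    ∃ M : ℝ, IsGreatest ((fun ξ => sectionVol K ξ) '' unitSphere n) M ∧
      vol K ^ (((n : ℝ) - 1) / n) ≤ sectionConst n * M := by
  obtain ⟨M, hM⟩ := exists_isGreatest_image hn (hK.isStarBody.continuousOn_sectionVol hn)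
  refine ⟨M, hM, ?_⟩
  rcases hn.eq_or_lt with rfl | hn
  · obtain ⟨ξ, hξ, h⟩ := hM.1
    have hM1 : M = 1 :=
      h.symm.trans (sectionVol_eq_one (interior_subset hK.isStarBody.zero_mem_interior) hξ)
    have h0 : vol (closedBall (0 : E (1 - 1)) 1) = 1 :=
      measureReal_euclidean_zero (mem_closedBall_self zero_le_one)
    rw [sectionConst, h0, hM1]
    simp
  · refine hK.vol_rpow_le_of_section_le hn (fun ξ hξ => hM.2 ⟨ξ, hξ, rfl⟩) ?_
    obtain ⟨ξ, -, h⟩ := hM.1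
    exact h ▸ measureReal_nonneg

end VolumeInequality

/-! ### The Prékopa–Leindler inequality -/

section PrekopaLeindler

/-- The one-dimensional Brunn–Minkowski inequality for compact sets: the translates `A + min B` and
`max A + B` overlap in a single point. -/
theorem volume_add_le_of_isCompact {A B C : Set ℝ} (hA : IsCompact A) (hB : IsCompact B)
    (hA0 : A.Nonempty) (hB0 : B.Nonempty) (h : ∀ a ∈ A, ∀ b ∈ B, a + b ∈ C) :
    volume A + volume B ≤ volume C := by
  set M := sSup A
  set m := sInf B
  have hM : M ∈ A := hA.sSup_mem hA0
  have hm : m ∈ B := hB.sInf_mem hB0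
  have h1 : volume ((fun x => x + -m) ⁻¹' A) = volume A := measure_preimage_add_right _ _ _
  have h2 : volume ((fun x => x + -M) ⁻¹' B) = volume B := measure_preimage_add_right _ _ _
  have hdisj : AEDisjoint volume ((fun x => x + -m) ⁻¹' A) ((fun x => x + -M) ⁻¹' B) := by
    refine measure_mono_null (t := {M + m}) ?_ (by simp)
    rintro x ⟨hxA, hxB⟩
    have h3 : x + -m ≤ M := le_csSup hA.bddAbove hxA
    have h4 : m ≤ x + -M := csInf_le hB.bddBelow hxB
    exact le_antisymm (by linarith) (by linarith)
  rw [← h1, ← h2, ← measure_union₀ ((hB.measurableSet.preimage (by fun_prop)).nullMeasurableSet)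
    hdisj]
  refine measure_mono (union_subset (fun x hx => ?_) fun x hx => ?_)
  · simpa using h _ hx _ hm
  · simpa using h _ hM _ hx

theorem volume_add_le {A B C : Set ℝ} (hA : MeasurableSet A) (hB : MeasurableSet B)
    (hA0 : A.Nonempty) (hB0 : B.Nonempty) (h : ∀ a ∈ A, ∀ b ∈ B, a + b ∈ C) :
    volume A + volume B ≤ volume C := by
  obtain ⟨a₀, ha₀⟩ := hA0
  obtain ⟨b₀, hb₀⟩ := hB0
  rw [hA.measure_eq_iSup_isCompact, hB.measure_eq_iSup_isCompact]
  simp only [iSup_and']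
  refine ENNReal.biSup_add_biSup_le' ⟨∅, empty_subset _, isCompact_empty⟩
    ⟨∅, empty_subset _, isCompact_empty⟩ fun S hS S' hS' => ?_
  refine (add_le_add (measure_mono (subset_insert a₀ S)) (measure_mono (subset_insert b₀ S'))).trans
    (volume_add_le_of_isCompact (hS.2.insert _) (hS'.2.insert _) (insert_nonempty _ _)
      (insert_nonempty _ _) fun a ha b hb => h a ?_ b ?_)
  · exact insert_subset ha₀ hS.1 ha
  · exact insert_subset hb₀ hS'.1 hb

theorem volume_convex_combination_le {α β : ℝ} (hα : 0 < α) (hβ : 0 < β) {A B C : Set ℝ}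
    (hA : MeasurableSet A) (hB : MeasurableSet B) (hA0 : A.Nonempty) (hB0 : B.Nonempty)
    (h : ∀ a ∈ A, ∀ b ∈ B, α * a + β * b ∈ C) :
    ENNReal.ofReal α * volume A + ENNReal.ofReal β * volume B ≤ volume C := by
  have hs : ∀ {c : ℝ}, 0 < c → ∀ S : Set ℝ, volume (c • S) = ENNReal.ofReal c * volume S := by
    intro c hc S
    rw [Measure.addHaar_smul, Module.finrank_self, pow_one, abs_of_pos hc]
  rw [← hs hα, ← hs hβ]
  refine volume_add_le (hA.const_smul₀ α) (hB.const_smul₀ β) hA0.smul_set hB0.smul_set ?_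
  rintro _ ⟨a, ha, rfl⟩ _ ⟨b, hb, rfl⟩
  exact h a ha b hb

/-- The layer-cake formula for functions bounded by `1`. -/
theorem lintegral_eq_lintegral_superlevel {X : Type*} [MeasurableSpace X] {μ : Measure X}
    {f : X → ℝ≥0∞} (hf : Measurable f) (h1 : ∀ x, f x ≤ 1) :
    ∫⁻ x, f x ∂μ = ∫⁻ t in Ioo (0 : ℝ) 1, μ {x | ENNReal.ofReal t < f x} := by
  have htop : ∀ x, f x ≠ ∞ := fun x => ((h1 x).trans_lt ENNReal.one_lt_top).ne
  calc ∫⁻ x, f x ∂μ = ∫⁻ x, ENNReal.ofReal (f x).toReal ∂μ := by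
        simp only [ENNReal.ofReal_toReal (htop _)]
    _ = ∫⁻ t in Ioi (0 : ℝ), μ {x | t < (f x).toReal} :=
        lintegral_eq_lintegral_meas_lt μ (.of_forall fun x => ENNReal.toReal_nonneg)
          hf.ennreal_toReal.aemeasurable
    _ = ∫⁻ t in Ioi (0 : ℝ), (Iio (1 : ℝ)).indicator (fun t => μ {x | ENNReal.ofReal t < f x}) t := by
        refine setLIntegral_congr_fun measurableSet_Ioi fun t ht => ?_
        have h0 : {x | t < (f x).toReal} = {x | ENNReal.ofReal t < f x} := by
          ext x
          exact (ENNReal.ofReal_lt_iff_lt_toReal (le_of_lt ht) (htop x)).symm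
        by_cases h : t < 1
        · rw [indicator_of_mem (show t ∈ Iio (1 : ℝ) from h), ← h0]
        · rw [indicator_of_notMem (show t ∉ Iio (1 : ℝ) from h), h0]
          have : {x | ENNReal.ofReal t < f x} = ∅ := by
            refine eq_empty_of_forall_notMem fun x hx => ?_
            have h2 := lt_of_lt_of_le hx (h1 x)
            rw [ENNReal.ofReal_lt_one] at h2
            exact h h2
          rw [this, measure_empty]
    _ = _ := by rw [setLIntegral_indicator measurableSet_Iio, Iio_inter_Ioi]

theorem ennreal_geom_mean_le_arith_mean {α β : ℝ} (hα : 0 < α) (hβ : 0 < β) (hαβ : α + β = 1)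
    (u v : ℝ≥0∞) : u ^ α * v ^ β ≤ ENNReal.ofReal α * u + ENNReal.ofReal β * v := by
  induction u with
  | top => simp [ENNReal.mul_top, hα]
  | coe u =>
    induction v with
    | top => simp [ENNReal.mul_top, hβ]
    | coe v =>
      have h := NNReal.geom_mean_le_arith_mean2_weighted ⟨α, hα.le⟩ ⟨β, hβ.le⟩ u v
        (NNReal.eq hαβ)
      rw [← ENNReal.coe_rpow_of_nonneg _ hα.le, ← ENNReal.coe_rpow_of_nonneg _ hβ.le,
        ENNReal.ofReal_eq_coe_nnreal hα.le, ENNReal.ofReal_eq_coe_nnreal hβ.le]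
      exact_mod_cast h

/-- The additive form of the one-dimensional Prékopa–Leindler inequality, for functions with
supremum `1`: the superlevel sets satisfy the Brunn–Minkowski inequality. -/
theorem add_le_lintegral_of_iSup_eq_one {α β : ℝ} (hα : 0 < α) (hβ : 0 < β) (hαβ : α + β = 1)
    {f g h : ℝ → ℝ≥0∞} (hf : Measurable f) (hg : Measurable g) (hh : Measurable h)
    (hf1 : ⨆ x, f x = 1) (hg1 : ⨆ x, g x = 1)
    (hfg : ∀ x y, f x ^ α * g y ^ β ≤ h (α * x + β * y)) :
    ENNReal.ofReal α * (∫⁻ x, f x) + ENNReal.ofReal β * (∫⁻ x, g x) ≤ ∫⁻ x, h x := by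
  refine le_trans ?_ (lintegral_mono fun x => min_le_left (h x) 1)
  have hf' : ∀ x, f x ≤ 1 := fun x => (le_iSup f x).trans_eq hf1
  have hg' : ∀ x, g x ≤ 1 := fun x => (le_iSup g x).trans_eq hg1
  rw [lintegral_eq_lintegral_superlevel (μ := volume) hf hf',
    lintegral_eq_lintegral_superlevel (μ := volume) hg hg',
    lintegral_eq_lintegral_superlevel (μ := volume) (hh.min measurable_const)
      (fun x => min_le_right _ _),
    ← lintegral_const_mul' _ _ ENNReal.ofReal_ne_top, ← lintegral_const_mul' _ _ ENNReal.ofReal_ne_top]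
  have hanti : Antitone fun t : ℝ => volume {x | ENNReal.ofReal t < f x} := fun s t hst =>
    measure_mono fun x hx => lt_of_le_of_lt (ENNReal.ofReal_le_ofReal hst) hx
  rw [← lintegral_add_left (hanti.measurable.const_mul _)]
  refine setLIntegral_mono' measurableSet_Ioo fun t ht => ?_
  have ht1 : ENNReal.ofReal t < 1 := ENNReal.ofReal_lt_one.2 ht.2
  refine volume_convex_combination_le hα hβ (measurableSet_lt measurable_const hf)
    (measurableSet_lt measurable_const hg) ?_ ?_ ?_
  · rw [← hf1] at ht1
    exact lt_iSup_iff.1 ht1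
  · rw [← hg1] at ht1
    exact lt_iSup_iff.1 ht1
  · intro a ha b hb
    refine lt_min (lt_of_lt_of_le ?_ (hfg a b)) ht1
    calc ENNReal.ofReal t = ENNReal.ofReal t ^ α * ENNReal.ofReal t ^ β := by
          rw [← ENNReal.rpow_add_of_nonneg _ _ hα.le hβ.le, hαβ, ENNReal.rpow_one]
      _ < f a ^ α * g b ^ β :=
        ENNReal.mul_lt_mul (ENNReal.rpow_lt_rpow ha hα) (ENNReal.rpow_lt_rpow hb hβ)

theorem prekopaLeindler_real_of_bounded {α β : ℝ} (hα : 0 < α) (hβ : 0 < β) (hαβ : α + β = 1)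
    {f g h : ℝ → ℝ≥0∞} (hf : Measurable f) (hg : Measurable g) (hh : Measurable h)
    (hf1 : ⨆ x, f x ≠ ∞) (hg1 : ⨆ x, g x ≠ ∞)
    (hfg : ∀ x y, f x ^ α * g y ^ β ≤ h (α * x + β * y)) :
    (∫⁻ x, f x) ^ α * (∫⁻ x, g x) ^ β ≤ ∫⁻ x, h x := by
  set a := ⨆ x, f x with ha
  set b := ⨆ x, g x with hb
  rcases eq_or_ne a 0 with ha0 | ha0
  · have : ∀ x, f x = 0 := fun x => le_antisymm (ha0 ▸ le_iSup f x) bot_le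
    simp [this, ENNReal.zero_rpow_of_pos hα]
  rcases eq_or_ne b 0 with hb0 | hb0
  · have : ∀ x, g x = 0 := fun x => le_antisymm (hb0 ▸ le_iSup g x) bot_le
    simp [this, ENNReal.zero_rpow_of_pos hβ]
  set c := a ^ α * b ^ β with hc
  have haα : a ^ α ≠ 0 := by simp [ENNReal.rpow_eq_zero_iff, ha0, hf1]
  have hbβ : b ^ β ≠ 0 := by simp [ENNReal.rpow_eq_zero_iff, hb0, hg1]
  have haα' : a ^ α ≠ ∞ := ENNReal.rpow_ne_top_of_nonneg hα.le hf1
  have hbβ' : b ^ β ≠ ∞ := ENNReal.rpow_ne_top_of_nonneg hβ.le hg1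
  have hc0 : c ≠ 0 := mul_ne_zero haα hbβ
  have hct : c ≠ ∞ := ENNReal.mul_ne_top haα' hbβ'
  have hcinv : c⁻¹ = (a⁻¹) ^ α * (b⁻¹) ^ β := by
    rw [ENNReal.inv_rpow, ENNReal.inv_rpow, ENNReal.mul_inv (Or.inl haα) (Or.inl haα')]
  have hnorm := add_le_lintegral_of_iSup_eq_one hα hβ hαβ (hf.const_mul a⁻¹) (hg.const_mul b⁻¹)
    (hh.const_mul c⁻¹)
    (by rw [← ENNReal.mul_iSup, ENNReal.inv_mul_cancel ha0 hf1])
    (by rw [← ENNReal.mul_iSup, ENNReal.inv_mul_cancel hb0 hg1])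
    (fun x y => by
      rw [ENNReal.mul_rpow_of_nonneg _ _ hα.le, ENNReal.mul_rpow_of_nonneg _ _ hβ.le, hcinv,
        mul_mul_mul_comm]
      gcongr
      exact hfg x y)
  have h1 := (ennreal_geom_mean_le_arith_mean hα hβ hαβ _ _).trans hnorm
  rw [lintegral_const_mul _ hf, lintegral_const_mul _ hg, lintegral_const_mul _ hh,
    ENNReal.mul_rpow_of_nonneg _ _ hα.le, ENNReal.mul_rpow_of_nonneg _ _ hβ.le,
    mul_mul_mul_comm, ← hcinv] at h1
  exact (ENNReal.mul_le_mul_iff_right (ENNReal.inv_ne_zero.2 hct) (ENNReal.inv_ne_top.2 hc0)).1 h1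

theorem tendsto_lintegral_min_natCast {X : Type*} [MeasurableSpace X] {μ : Measure X}
    {f : X → ℝ≥0∞} (hf : Measurable f) :
    Tendsto (fun k : ℕ => ∫⁻ x, min (f x) k ∂μ) atTop (𝓝 (∫⁻ x, f x ∂μ)) := by
  refine lintegral_tendsto_of_tendsto_of_monotone
    (fun k => (hf.min measurable_const).aemeasurable)
    (.of_forall fun x k l hkl => min_le_min le_rfl (by exact_mod_cast hkl)) (.of_forall fun x => ?_)
  have := (tendsto_const_nhds (x := f x)).min ENNReal.tendsto_nat_nhds_top
  simpa using this

theorem prekopaLeindler_real {α β : ℝ} (hα : 0 < α) (hβ : 0 < β) (hαβ : α + β = 1)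
    {f g h : ℝ → ℝ≥0∞} (hf : Measurable f) (hg : Measurable g) (hh : Measurable h)
    (hfg : ∀ x y, f x ^ α * g y ^ β ≤ h (α * x + β * y)) :
    (∫⁻ x, f x) ^ α * (∫⁻ x, g x) ^ β ≤ ∫⁻ x, h x := by
  rcases eq_or_ne (∫⁻ x, f x) 0 with hf0 | hf0
  · simp [hf0, ENNReal.zero_rpow_of_pos hα]
  rcases eq_or_ne (∫⁻ x, g x) 0 with hg0 | hg0
  · simp [hg0, ENNReal.zero_rpow_of_pos hβ]
  have hlim := ENNReal.Tendsto.mul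
    (((ENNReal.continuous_rpow_const (y := α)).tendsto _).comp
      (tendsto_lintegral_min_natCast (μ := volume) hf))
    (Or.inl (by simp [ENNReal.rpow_eq_zero_iff, hf0, not_lt.2 hα.le]))
    (((ENNReal.continuous_rpow_const (y := β)).tendsto _).comp
      (tendsto_lintegral_min_natCast (μ := volume) hg))
    (Or.inl (by simp [ENNReal.rpow_eq_zero_iff, hg0, not_lt.2 hβ.le]))
  refine le_of_tendsto' hlim fun k => ?_
  have hb : ∀ u : ℝ → ℝ≥0∞, ⨆ x, min (u x) k ≠ ∞ := fun u =>
    ((iSup_le fun x => min_le_right _ _).trans_lt (ENNReal.natCast_lt_top k)).ne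
  refine prekopaLeindler_real_of_bounded hα hβ hαβ (hf.min measurable_const)
    (hg.min measurable_const) hh (hb f) (hb g) fun x y => le_trans ?_ (hfg x y)
  gcongr
  · exact min_le_left _ _
  · exact min_le_left _ _

/-- The Prékopa–Leindler inequality, by induction on the dimension: slicing along a unit vector
reduces it to dimension one. -/
theorem prekopaLeindler {α β : ℝ} (hα : 0 < α) (hβ : 0 < β) (hαβ : α + β = 1) (d : ℕ) :
    ∀ (V : Type) [NormedAddCommGroup V] [InnerProductSpace ℝ V] [FiniteDimensional ℝ V]
      [MeasurableSpace V] [BorelSpace V], Module.finrank ℝ V = d →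
      ∀ {f g h : V → ℝ≥0∞}, Measurable f → Measurable g → Measurable h →
        (∀ x y, f x ^ α * g y ^ β ≤ h (α • x + β • y)) →
        (∫⁻ x, f x) ^ α * (∫⁻ x, g x) ^ β ≤ ∫⁻ x, h x := by
  induction d with
  | zero =>
    intro V _ _ _ _ _ hd f g h hf hg hh hfg
    have hsub : Subsingleton V := Module.finrank_zero_iff.1 hd
    have hone : volume (univ : Set V) = 1 := by
      have e : E 0 ≃ₗᵢ[ℝ] V :=
        ((stdOrthonormalBasis ℝ V).reindex (finCongr hd)).repr.symm
      rw [← e.measurePreserving.measure_preimage MeasurableSet.univ.nullMeasurableSet, preimage_univ,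
        volume_euclideanSpace_eq_dirac]
      simp
    have hc : ∀ u : V → ℝ≥0∞, ∫⁻ x, u x = u 0 := fun u => by
      rw [lintegral_congr fun x => congrArg u (Subsingleton.elim x 0), lintegral_const, hone, mul_one]
    rw [hc, hc, hc]
    simpa using hfg 0 0
  | succ d ih =>
    intro V _ _ _ _ _ hd f g h hf hg hh hfg
    have : Nontrivial V := Module.nontrivial_of_finrank_pos (R := ℝ) (by omega)
    obtain ⟨ξ, hξ⟩ := exists_norm_eq V zero_le_one
    have hmeas : ∀ {u : V → ℝ≥0∞}, Measurable u → Measurable fun w :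
        ℝ × (Submodule.span ℝ {ξ})ᗮ => u ((w.2 : V) + w.1 • ξ) := by
      intro u hu
      fun_prop
    have hm : ∀ {u : V → ℝ≥0∞}, Measurable u → Measurable fun t : ℝ =>
        ∫⁻ y : (Submodule.span ℝ {ξ})ᗮ, u ((y : V) + t • ξ) := fun hu =>
      (hmeas hu).lintegral_prod_right'
    rw [lintegral_slice hξ hf, lintegral_slice hξ hg, lintegral_slice hξ hh]
    refine prekopaLeindler_real hα hβ hαβ (hm hf) (hm hg) (hm hh) fun s t => ?_
    refine ih (Submodule.span ℝ {ξ})ᗮ (by rw [finrank_orthogonal_span hξ, hd]; rfl)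
      ((hmeas hf).comp measurable_prodMk_left) ((hmeas hg).comp measurable_prodMk_left)
      ((hmeas hh).comp measurable_prodMk_left) fun x y => ?_
    refine (hfg _ _).trans_eq (congrArg h ?_)
    simp only [Submodule.coe_add, Submodule.coe_smul]
    module

end PrekopaLeindler

/-! ### Parallel sections of symmetric convex bodies -/

section Slices

variable {n : ℕ} {K : Set (E n)}

/-- For an origin-symmetric convex body, moving a hyperplane section halfway towards the origin
does not decrease its volume: the section at height `t / 2` contains `3/4` of the one at height `t`
plus `1/4` of the reflected one at height `-t`. -/
theorem volume_slice_le_volume_slice_half (hK : Convex ℝ K) (hKc : IsClosed K)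
    (hsymm : IsOriginSymmetric K) (ξ : E n) (t : ℝ) :
    volume {z : perp ξ | (z : E n) + t • ξ ∈ K} ≤
      volume {z : perp ξ | (z : E n) + (t / 2) • ξ ∈ K} := by
  have hm : ∀ s : ℝ, MeasurableSet {z : perp ξ | (z : E n) + s • ξ ∈ K} := fun s =>
    hKc.measurableSet.preimage (by fun_prop : Measurable fun z : perp ξ => (z : E n) + s • ξ)
  have hneg : volume {z : perp ξ | (z : E n) + (-t) • ξ ∈ K} =
      volume {z : perp ξ | (z : E n) + t • ξ ∈ K} := by
    rw [← Measure.measure_preimage_neg]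
    congr 1
    ext z
    have hs : ∀ x, -x ∈ K ↔ x ∈ K := fun x => by rw [← Set.mem_neg, hsymm]
    simp only [mem_preimage, mem_ofPred_eq]
    rw [← hs]
    simp [add_comm]
  have h34 : (0 : ℝ) < 3 / 4 := by norm_num
  have h14 : (0 : ℝ) < 1 / 4 := by norm_num
  have h := prekopaLeindler h34 h14 (by norm_num) _ (perp ξ) rfl
    (measurable_one.indicator (hm t)) (measurable_one.indicator (hm (-t)))
    (measurable_one.indicator (hm (t / 2))) (fun x y => by
      by_cases hx : (x : E n) + t • ξ ∈ K
      · by_cases hy : (y : E n) + (-t) • ξ ∈ K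
        · have hxy : ((((3 : ℝ) / 4) • x + ((1 : ℝ) / 4) • y : perp ξ) : E n) + (t / 2) • ξ ∈ K := by
            have := hK hx hy h34.le h14.le (by norm_num)
            convert this using 1
            simp only [Submodule.coe_add, Submodule.coe_smul]
            module
          have hx' : x ∈ {z : perp ξ | (z : E n) + t • ξ ∈ K} := hx
          have hy' : y ∈ {z : perp ξ | (z : E n) + (-t) • ξ ∈ K} := hy
          rw [indicator_of_mem hx', indicator_of_mem hy', indicator_of_mem (by exact hxy)]
          simp
        · rw [indicator_of_notMem (s := {z : perp ξ | (z : E n) + (-t) • ξ ∈ K}) hy,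
            ENNReal.zero_rpow_of_pos h14, mul_zero]
          exact zero_le
      · rw [indicator_of_notMem (s := {z : perp ξ | (z : E n) + t • ξ ∈ K}) hx,
          ENNReal.zero_rpow_of_pos h34, zero_mul]
        exact zero_le)
  rw [lintegral_indicator_one (hm _), lintegral_indicator_one (hm _), lintegral_indicator_one (hm _),
    hneg, ← ENNReal.rpow_add_of_nonneg _ _ h34.le h14.le] at h
  norm_num at h
  exact h

theorem lintegral_comp_mul_left {c : ℝ} (hc : 0 < c) {F : ℝ → ℝ≥0∞} (hF : Measurable F) :
    ∫⁻ t, F (c * t) = ENNReal.ofReal c⁻¹ * ∫⁻ t, F t := by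
  rw [← lintegral_map hF (measurable_const_mul c), Real.map_volume_mul_left hc.ne',
    lintegral_smul_measure, abs_of_pos (inv_pos.2 hc), smul_eq_mul]

/-- The integral over `K` of a function of the height over `ξ^⊥`, by parallel sections. -/
theorem setLIntegral_slice {ξ : E n} (hξ : ξ ∈ unitSphere n) (hK : MeasurableSet K)
    {b : ℝ → ℝ≥0∞} (hb : Measurable b) :
    ∫⁻ z in K, b ⟪z, ξ⟫ = ∫⁻ t : ℝ, b t * volume {z : perp ξ | (z : E n) + t • ξ ∈ K} := by
  have hξn : ‖ξ‖ = 1 := by simpa using hξ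
  rw [← lintegral_indicator hK, lintegral_slice hξn (by
    refine Measurable.indicator ?_ hK
    fun_prop)]
  refine lintegral_congr fun t => ?_
  have hm : MeasurableSet {z : perp ξ | (z : E n) + t • ξ ∈ K} :=
    hK.preimage (by fun_prop : Measurable fun z : perp ξ => (z : E n) + t • ξ)
  rw [← lintegral_indicator_one hm, ← lintegral_const_mul _ (measurable_one.indicator hm)]
  refine lintegral_congr fun z => ?_
  have h0 : ⟪(z : E n) + t • ξ, ξ⟫ = t := by
    rw [inner_add_left, Submodule.mem_orthogonal_singleton_iff_inner_left.1 z.2,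
      inner_smul_left, real_inner_self_eq_norm_sq, hξn]
    simp
  by_cases h : (z : E n) + t • ξ ∈ K <;> simp [indicator, h, h0]

/-- Concentrating a weight twofold around the hyperplane `ξ^⊥` does not decrease the weighted volume
of an origin-symmetric convex body. -/
theorem setLIntegral_inner_le (hK : Convex ℝ K) (hKc : IsClosed K)
    (hsymm : IsOriginSymmetric K) {ξ : E n} (hξ : ξ ∈ unitSphere n)
    {b : ℝ → ℝ≥0∞} (hb : Measurable b) :
    ∫⁻ z in K, b ⟪z, ξ⟫ ≤ 2 * ∫⁻ z in K, b (2 * ⟪z, ξ⟫) := by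
  have hm : Measurable fun t : ℝ => volume {z : perp ξ | (z : E n) + (t / 2) • ξ ∈ K} := by
    have hs : MeasurableSet {w : ℝ × perp ξ | (w.2 : E n) + (w.1 / 2) • ξ ∈ K} :=
      hKc.measurableSet.preimage
        (by fun_prop : Measurable fun w : ℝ × perp ξ => (w.2 : E n) + (w.1 / 2) • ξ)
    exact measurable_measure_prodMk_left hs
  rw [setLIntegral_slice hξ hKc.measurableSet hb, setLIntegral_slice hξ hKc.measurableSet
    (b := fun s => b (2 * s)) (by fun_prop)]
  have h := lintegral_comp_mul_left two_pos (hb.mul hm)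
  have h2 : (2 : ℝ≥0∞) * ENNReal.ofReal (2 : ℝ)⁻¹ = 1 := by
    rw [← ENNReal.ofReal_ofNat 2, ← ENNReal.ofReal_mul (by norm_num)]
    norm_num
  simp only [Pi.mul_apply, mul_div_cancel_left₀ _ (two_ne_zero (α := ℝ))] at h
  rw [h, ← mul_assoc, h2, one_mul]
  exact lintegral_mono fun t =>
    mul_le_mul_right (volume_slice_le_volume_slice_half hK hKc hsymm ξ t) _

end Slices

/-! ### Ellipsoids and spherical means -/

section Ellipsoid

variable {V : Type*} [NormedAddCommGroup V] [InnerProductSpace ℝ V]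

/-- The Minkowski functional of the ellipsoid `{v | c² ‖v‖² + ⟨w, v⟩² ≤ 1}`. -/
noncomputable def ellipsoidGauge (c : ℝ) (w v : V) : ℝ := √(c ^ 2 * ‖v‖ ^ 2 + ⟪w, v⟫ ^ 2)

theorem isRayGauge_ellipsoidGauge {c : ℝ} (hc : 0 < c) (w : V) :
    IsRayGauge (ellipsoidGauge c w) where
  continuous := by unfold ellipsoidGauge; fun_prop
  smul_of_nonneg t x ht := by
    rw [ellipsoidGauge, ellipsoidGauge, norm_smul, inner_smul_right, Real.norm_of_nonneg ht,
      ← Real.sqrt_sq ht, ← Real.sqrt_mul (sq_nonneg _), Real.sqrt_sq ht]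
    congr 1
    ring
  pos x hx := by
    have : 0 < ‖x‖ := norm_pos_iff.2 hx
    exact Real.sqrt_pos.2 (by positivity)

variable [FiniteDimensional ℝ V] [MeasurableSpace V] [BorelSpace V]

/-- The volume of the ellipsoid: stretching by `s = √(c² + ‖w‖²) / c` in the direction of `w` turns it
into the ball of radius `1 / c`. -/
theorem volume_ellipsoid [Nontrivial V] {c : ℝ} (hc : 0 < c) (w : V) :
    volume {v : V | ellipsoidGauge c w v ≤ 1} =
      ENNReal.ofReal (c⁻¹ ^ Module.finrank ℝ V * (c * (√(c ^ 2 + ‖w‖ ^ 2))⁻¹)) *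
        volume (closedBall (0 : V) 1) := by
  obtain ⟨ξ, hξ, hwξ⟩ : ∃ ξ : V, ‖ξ‖ = 1 ∧ w = ‖w‖ • ξ := by
    rcases eq_or_ne w 0 with rfl | hw
    · obtain ⟨ξ, hξ⟩ := exists_norm_eq V zero_le_one
      exact ⟨ξ, hξ, by simp⟩
    · have hw' := norm_ne_zero_iff.2 hw
      exact ⟨‖w‖⁻¹ • w, by simp [norm_smul, hw'], by simp [smul_smul, hw']⟩
  set s := c⁻¹ * √(c ^ 2 + ‖w‖ ^ 2) with hs
  have hs0 : 0 < s := mul_pos (inv_pos.2 hc) (Real.sqrt_pos.2 (by positivity))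
  have hs2 : c ^ 2 * s ^ 2 = c ^ 2 + ‖w‖ ^ 2 := by
    rw [hs, mul_pow, Real.sq_sqrt (by positivity)]
    field_simp
  have hm1 : MeasurableSet {v : V | ellipsoidGauge c w v ≤ 1} :=
    (isRayGauge_ellipsoidGauge hc w).isClosed_le.measurableSet
  have hnorm : ∀ (y : (Submodule.span ℝ {ξ})ᗮ) (t : ℝ),
      ‖(y : V) + t • ξ‖ ^ 2 = ‖y‖ ^ 2 + t ^ 2 := fun y t => by
    rw [norm_add_sq_real, inner_smul_right,
      Submodule.mem_orthogonal_singleton_iff_inner_left.1 y.2, norm_smul, hξ, mul_one,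
      Real.norm_eq_abs, sq_abs, Submodule.coe_norm]
    ring
  have hinner : ∀ (y : (Submodule.span ℝ {ξ})ᗮ) (t : ℝ), ⟪w, (y : V) + t • ξ⟫ = ‖w‖ * t :=
    fun y t => by
      conv_lhs => rw [hwξ]
      rw [real_inner_smul_left, inner_add_right,
        Submodule.mem_orthogonal_singleton_iff_inner_right.1 y.2, inner_smul_right,
        real_inner_self_eq_norm_sq, hξ]
      ring
  have hball : ∀ v : V, v ∈ closedBall (0 : V) c⁻¹ ↔ c ^ 2 * ‖v‖ ^ 2 ≤ 1 := fun v => by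
    rw [mem_closedBall_zero_iff, ← mul_pow, sq_le_one_iff₀ (by positivity), inv_eq_one_div,
      le_div_iff₀' hc]
  have hmem : ∀ (y : (Submodule.span ℝ {ξ})ᗮ) (t : ℝ),
      (y : V) + t • ξ ∈ {v : V | ellipsoidGauge c w v ≤ 1} ↔
        (y : V) + (s * t) • ξ ∈ closedBall (0 : V) c⁻¹ := by
    intro y t
    rw [hball, mem_ofPred_eq, ellipsoidGauge, Real.sqrt_le_one, hnorm, hinner, hnorm, mul_pow,
      mul_pow, mul_add, mul_add, ← mul_assoc (c ^ 2) (s ^ 2), hs2]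
    ring_nf
  rw [← lintegral_indicator_one hm1, lintegral_slice' hξ (measurable_one.indicator hm1)]
  have h1 : ∀ y : (Submodule.span ℝ {ξ})ᗮ,
      ∫⁻ t : ℝ, {v : V | ellipsoidGauge c w v ≤ 1}.indicator (1 : V → ℝ≥0∞) ((y : V) + t • ξ) =
      ENNReal.ofReal s⁻¹ *
        ∫⁻ t : ℝ, (closedBall (0 : V) c⁻¹).indicator (1 : V → ℝ≥0∞) ((y : V) + t • ξ) := by
    intro y
    rw [← lintegral_comp_mul_left hs0 (F := fun t =>
      (closedBall (0 : V) c⁻¹).indicator (1 : V → ℝ≥0∞) ((y : V) + t • ξ))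
      ((measurable_one.indicator measurableSet_closedBall).comp (by fun_prop))]
    refine lintegral_congr fun t => ?_
    by_cases h : (y : V) + (s * t) • ξ ∈ closedBall (0 : V) c⁻¹
    · rw [indicator_of_mem h, indicator_of_mem ((hmem y t).2 h)]; simp
    · rw [indicator_of_notMem h, indicator_of_notMem (fun h' => h ((hmem y t).1 h'))]
  simp only [h1]
  rw [lintegral_const_mul' _ _ ENNReal.ofReal_ne_top, ← lintegral_slice' hξ
    (measurable_one.indicator measurableSet_closedBall), lintegral_indicator_one
    measurableSet_closedBall, Measure.addHaar_closedBall' _ _ (by positivity), ← mul_assoc,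
    ← ENNReal.ofReal_mul (by positivity)]
  congr 2
  rw [hs, mul_inv, inv_inv]
  ring

/-- The spherical mean of `(c² + ⟨w, v⟩²)^{-d/2}`, where `d` is the dimension: by polar coordinates
it is the volume of an ellipsoid. -/
theorem integral_sphere_ellipsoid [Nontrivial V] {c : ℝ} (hc : 0 < c) (w : V) :
    ∫ v : sphere (0 : V) 1, (√(c ^ 2 + ⟪w, (v : V)⟫ ^ 2))⁻¹ ^ Module.finrank ℝ V
      ∂(volume : Measure V).toSphere =
    Module.finrank ℝ V * volume.real (closedBall (0 : V) 1) * c⁻¹ ^ Module.finrank ℝ V *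
      (c * (√(c ^ 2 + ‖w‖ ^ 2))⁻¹) := by
  have h := (isRayGauge_ellipsoidGauge hc w).real_volume_le_one
  have hd : (Module.finrank ℝ V : ℝ) ≠ 0 := by exact_mod_cast Module.finrank_pos.ne'
  rw [measureReal_def, volume_ellipsoid hc, ENNReal.toReal_mul,
    ENNReal.toReal_ofReal (by positivity), eq_div_iff hd] at h
  simp only [ellipsoidGauge, norm_eq_of_mem_sphere, one_pow, mul_one] at h
  rw [← h, measureReal_def]
  ring

end Ellipsoid

/-! ### Intersection bodies with prescribed density -/

section RadonTransform

variable {n : ℕ}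

theorem perp_neg (ξ : E n) : perp (-ξ) = perp ξ := by
  rw [perp, perp, ← Set.neg_singleton, Submodule.span_neg]

theorem sectionVol_neg (K : Set (E n)) (ξ : E n) : sectionVol K (-ξ) = sectionVol K ξ :=
  congrArg (fun W : Submodule ℝ (E n) => (volume : Measure W).real {x : W | (x : E n) ∈ K})
    (perp_neg ξ)

theorem sectionVol_pos {p : E n → ℝ} (hp : IsRayGauge p) (ξ : E n) :
    0 < sectionVol {x | p x ≤ 1} ξ := by
  have hr : IsRayGauge fun z : perp ξ => p z :=
    hp.comp_linear (perp ξ).subtypeL Subtype.val_injective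
  refine ENNReal.toReal_pos (Measure.measure_pos_of_mem_nhds (x := 0) _ ?_).ne'
    hr.volume_le_lt_top.ne
  have : ∀ᶠ z : perp ξ in 𝓝 0, p z < 1 :=
    (hr.continuous.tendsto 0).eventually (gt_mem_nhds (by simp [hp.map_zero]))
  exact this.mono fun z hz => hz.le

/-- The spherical Radon transform of a positive continuous even function is, up to the factor
`n - 1`, the radial function of the intersection body of a star body. -/
theorem exists_isIntersectionBodyOf (hn : 2 ≤ n) {G : E n → ℝ}
    (hc : ContinuousOn G (unitSphere n)) (hpos : ∀ ξ ∈ unitSphere n, 0 < G ξ)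
    (heven : ∀ ξ ∈ unitSphere n, G (-ξ) = G ξ) :
    ∃ K L : Set (E n), IsIntersectionBodyOf K L ∧ ∀ θ ∈ unitSphere n, radial K θ =
      (∫ v : sphere (0 : perp θ) 1, G ((v : perp θ) : E n) ∂(volume : Measure (perp θ)).toSphere) /
        (n - 1 : ℕ) := by
  have hd : (0 : ℝ) < (n - 1 : ℕ) := by exact_mod_cast (by omega : 0 < n - 1)
  obtain ⟨q, hq, hqe, hqG⟩ := exists_isRayGauge_of_radial
    (ρ := fun ξ => G ξ ^ ((1 : ℝ) / (n - 1 : ℕ)))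
    (hc.rpow_const fun ξ hξ => Or.inl (hpos ξ hξ).ne')
    (fun ξ hξ => Real.rpow_pos_of_pos (hpos ξ hξ) _) (fun ξ hξ => by simp only [heven ξ hξ])
  obtain ⟨p, hp, hpe, hpG⟩ := exists_isRayGauge_of_radial
    (ρ := sectionVol {x | q x ≤ 1}) (continuousOn_sectionVol hn hq)
    (fun ξ _ => sectionVol_pos hq ξ) (fun ξ _ => sectionVol_neg _ ξ)
  have hrad : ∀ θ ∈ unitSphere n, radial {x | p x ≤ 1} θ = sectionVol {x | q x ≤ 1} θ := by
    intro θ hθ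
    rw [radial, hp.gauge_eq, hpG θ hθ]
  refine ⟨{x | p x ≤ 1}, {x | q x ≤ 1}, ⟨hp.isStarBody hpe, IsRayGauge.isOriginSymmetric hpe,
    hq.isStarBody hqe, IsRayGauge.isOriginSymmetric hqe, hrad⟩, fun θ hθ => ?_⟩
  have hfr := finrank_perp hθ
  have : Nontrivial (perp θ) := Module.nontrivial_of_finrank_pos (R := ℝ) (by omega)
  have h := (hq.comp_linear (perp θ).subtypeL Subtype.val_injective).real_volume_le_one
  rw [hrad θ hθ]
  refine h.trans ?_
  rw [hfr]
  congr 1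
  refine integral_congr_ae (.of_forall fun v => ?_)
  have hv : ((v : perp θ) : E n) ∈ unitSphere n := by
    have := norm_eq_of_mem_sphere v
    rw [Submodule.coe_norm] at this
    simpa using this
  simp only [Submodule.subtypeL_apply]
  rw [hqG _ hv, ← Real.rpow_natCast, ← Real.rpow_mul (hpos _ hv).le, one_div,
    inv_mul_cancel₀ hd.ne', Real.rpow_one]

end RadonTransform

/-! ### An approximate inverse Radon transform of the radial function -/

section Density

variable {n : ℕ} {K : Set (E n)} {c : ℝ}

/-- The weight `(c² + s²)^{-(n-1)/2}`. -/
noncomputable def weight (n : ℕ) (c s : ℝ) : ℝ := (√(c ^ 2 + s ^ 2))⁻¹ ^ (n - 1)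

theorem weight_nonneg (n : ℕ) (c s : ℝ) : 0 ≤ weight n c s := by unfold weight; positivity

theorem continuous_weight (n : ℕ) (hc : 0 < c) : Continuous (weight n c) :=
  (Continuous.inv₀ (by fun_prop) fun s => (Real.sqrt_pos.2 (by positivity)).ne').pow _

theorem weight_le (n : ℕ) (hc : 0 < c) (s : ℝ) : weight n c s ≤ c⁻¹ ^ (n - 1) := by
  refine pow_le_pow_left₀ (by positivity) (inv_anti₀ hc ?_) _
  exact Real.le_sqrt_of_sq_le (by nlinarith [sq_nonneg s])

theorem weight_neg (n : ℕ) (c s : ℝ) : weight n c (-s) = weight n c s := by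
  simp [weight]

/-- An approximate inverse spherical Radon transform of the radial function of `K` at `ξ`, up to a
constant. In terms of the parallel section function `A(t) = |K ∩ (ξ^⊥ + t ξ)|` and the weight
`b(t) = (c² + t²)^{-(n-1)/2}` it is `∫ (A(t / 2) - A(t)) b(t) dt`. -/
noncomputable def density (K : Set (E n)) (c : ℝ) (ξ : E n) : ℝ :=
  ∫ z in K, (2 * weight n c (2 * ⟪z, ξ⟫) - weight n c ⟪z, ξ⟫)

theorem abs_density_integrand_le (hc : 0 < c) (s : ℝ) :
    ‖2 * weight n c (2 * s) - weight n c s‖ ≤ 2 * c⁻¹ ^ (n - 1) := by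
  have h1 := weight_le n hc s
  have h2 := weight_le n hc (2 * s)
  have h3 := weight_nonneg n c s
  have h4 := weight_nonneg n c (2 * s)
  rw [Real.norm_eq_abs, abs_le]
  constructor <;> linarith

theorem continuous_density (hc : 0 < c) (hK : IsCompact K) : Continuous (density K c) := by
  have hw := continuous_weight n hc
  have hfin : IsFiniteMeasure (volume.restrict K) := ⟨by simpa using hK.measure_lt_top⟩
  refine continuous_of_dominated (bound := fun _ => 2 * c⁻¹ ^ (n - 1)) (fun ξ => ?_)
    (fun ξ => .of_forall fun z => abs_density_integrand_le hc _) (integrable_const _)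
    (.of_forall fun z => by fun_prop)
  exact Continuous.aestronglyMeasurable (by fun_prop)

theorem density_neg (ξ : E n) : density K c (-ξ) = density K c ξ := by
  simp only [density, inner_neg_right, mul_neg, weight_neg]

/-- The density is nonnegative because `A(t / 2) ≥ A(t)`; this is where convexity is used. -/
theorem density_nonneg (hc : 0 < c) (hK : Convex ℝ K) (hKc : IsCompact K)
    (hsymm : IsOriginSymmetric K) {ξ : E n} (hξ : ξ ∈ unitSphere n) : 0 ≤ density K c ξ := by
  have hw := continuous_weight n hc
  have hfin : IsFiniteMeasure (volume.restrict K) := ⟨by simpa using hKc.measure_lt_top⟩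
  have hint : ∀ a : ℝ, Integrable (fun z => weight n c (a * ⟪z, ξ⟫)) (volume.restrict K) := by
    intro a
    refine Integrable.of_bound (Continuous.aestronglyMeasurable (by fun_prop)) (c⁻¹ ^ (n - 1))
      (.of_forall fun z => ?_)
    rw [Real.norm_of_nonneg (weight_nonneg _ _ _)]
    exact weight_le n hc _
  have h1 := hint 1
  simp only [one_mul] at h1
  rw [density, integral_sub ((hint 2).const_mul 2) h1, integral_const_mul, sub_nonneg,
    integral_eq_lintegral_of_nonneg_ae (.of_forall fun z => weight_nonneg _ _ _)
      h1.aestronglyMeasurable,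
    integral_eq_lintegral_of_nonneg_ae (.of_forall fun z => weight_nonneg _ _ _)
      (hint 2).aestronglyMeasurable]
  have h := setLIntegral_inner_le hK hKc.isClosed hsymm hξ
    (b := fun s => ENNReal.ofReal (weight n c s)) (by fun_prop)
  have h2 := ENNReal.toReal_mono (ENNReal.mul_ne_top (by simp) (hint 2).lintegral_lt_top.ne) h
  simpa [ENNReal.toReal_mul] using h2

/-- For the weight `b = weight n c`, the spherical mean over `v ∈ θ^⊥` of
`2 b(2 ⟨z, v⟩) - b(⟨z, v⟩)` is, up to a constant, this kernel at the norm of the projection of `z`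
to `θ^⊥`. It is of order `c² r⁻³` for `r` large compared with `c`. -/
noncomputable def kernel (c r : ℝ) : ℝ := (√((c / 2) ^ 2 + r ^ 2))⁻¹ - (√(c ^ 2 + r ^ 2))⁻¹

theorem kernel_eq (c r : ℝ) :
    kernel c r = 2 * (√(c ^ 2 + (2 * r) ^ 2))⁻¹ - (√(c ^ 2 + r ^ 2))⁻¹ := by
  have h : √(c ^ 2 + (2 * r) ^ 2) = 2 * √((c / 2) ^ 2 + r ^ 2) := by
    rw [show c ^ 2 + (2 * r) ^ 2 = 2 ^ 2 * ((c / 2) ^ 2 + r ^ 2) by ring,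
      Real.sqrt_mul (by norm_num), Real.sqrt_sq (by norm_num)]
  rw [kernel, h, mul_inv]
  ring

/-- The spherical Radon transform of the density, computed by Fubini's theorem. -/
theorem integral_density (hn : 2 ≤ n) (hc : 0 < c) (hKc : IsCompact K) {θ : E n}
    (hθ : θ ∈ unitSphere n) :
    (∫ v : sphere (0 : perp θ) 1, density K c ((v : perp θ) : E n)
      ∂(volume : Measure (perp θ)).toSphere) / (n - 1 : ℕ) =
    vol (closedBall (0 : E (n - 1)) 1) * c⁻¹ ^ (n - 1) * c *
      ∫ z in K, kernel c ‖(perp θ).orthogonalProjectionOnto z‖ := by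
  have hw := continuous_weight n hc
  have hfin : IsFiniteMeasure (volume.restrict K) := ⟨by simpa using hKc.measure_lt_top⟩
  have hfr := finrank_perp hθ
  have hd : (0 : ℝ) < (n - 1 : ℕ) := by exact_mod_cast (by omega : 0 < n - 1)
  have : Nontrivial (perp θ) := Module.nontrivial_of_finrank_pos (R := ℝ) (by omega)
  have hswap : ∫ v : sphere (0 : perp θ) 1, density K c ((v : perp θ) : E n)
      ∂(volume : Measure (perp θ)).toSphere =
      ∫ z in K, ∫ v : sphere (0 : perp θ) 1, (2 * weight n c (2 * ⟪z, ((v : perp θ) : E n)⟫) -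
        weight n c ⟪z, ((v : perp θ) : E n)⟫) ∂(volume : Measure (perp θ)).toSphere := by
    refine integral_integral_swap ?_
    refine Integrable.of_bound (Continuous.aestronglyMeasurable ?_) (2 * c⁻¹ ^ (n - 1))
      (.of_forall fun w => abs_density_integrand_le hc _)
    unfold Function.uncurry
    fun_prop
  rw [hswap, ← integral_div, ← integral_const_mul]
  refine integral_congr_ae (.of_forall fun z => ?_)
  set w := (perp θ).orthogonalProjectionOnto z with hwdef
  have hin : ∀ v : perp θ, ⟪z, (v : E n)⟫ = ⟪w, v⟫ := fun v =>
    (Submodule.inner_orthogonalProjectionOnto_eq_of_mem_right v z).symm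
  have hsph : ∀ a : ℝ, ∫ v : sphere (0 : perp θ) 1, weight n c (a * ⟪w, (v : perp θ)⟫)
      ∂(volume : Measure (perp θ)).toSphere =
      (n - 1 : ℕ) * vol (closedBall (0 : E (n - 1)) 1) * c⁻¹ ^ (n - 1) *
      (c * (√(c ^ 2 + (a * ‖w‖) ^ 2))⁻¹) := by
    intro a
    have h := integral_sphere_ellipsoid hc (a • w)
    rw [hfr, norm_smul, mul_pow, Real.norm_eq_abs, sq_abs, ← mul_pow] at h
    simp only [real_inner_smul_left] at h
    rw [vol, measureReal_def, ← volume_closedBall_perp hθ, ← measureReal_def, ← h]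
    rfl
  have hcont : ∀ a : ℝ, Integrable (fun v : sphere (0 : perp θ) 1 =>
      weight n c (a * ⟪w, (v : perp θ)⟫)) (volume : Measure (perp θ)).toSphere := fun a =>
    Continuous.integrable_of_hasCompactSupport (by fun_prop) (.of_compactSpace _)
  have h1 := hsph 1
  have h1' := hcont 1
  simp only [one_mul] at h1 h1'
  simp only [hin]
  rw [← hwdef, integral_sub ((hcont 2).const_mul 2) h1', integral_const_mul, hsph 2, h1, kernel_eq,
    div_eq_iff hd.ne']
  ring

end Density

/-! ### Concentration of the kernel -/

section Kernel

variable {c r δ R : ℝ}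

theorem kernel_nonneg (hc : 0 < c) (r : ℝ) : 0 ≤ kernel c r := by
  refine sub_nonneg.2 (inv_anti₀ (Real.sqrt_pos.2 (by positivity)) (Real.sqrt_le_sqrt ?_))
  nlinarith

theorem kernel_le (hc : 0 < c) (r : ℝ) : kernel c r ≤ 2 / c := by
  have h1 : c / 2 ≤ √((c / 2) ^ 2 + r ^ 2) := Real.le_sqrt_of_sq_le (by nlinarith [sq_nonneg r])
  have h2 := inv_anti₀ (by positivity) h1
  have h3 : 0 ≤ (√(c ^ 2 + r ^ 2))⁻¹ := by positivity
  rw [inv_div] at h2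
  rw [kernel]
  linarith

theorem continuous_kernel (hc : 0 < c) : Continuous (kernel c) :=
  (Continuous.inv₀ (by fun_prop) fun s => (Real.sqrt_pos.2 (by positivity)).ne').sub
    (Continuous.inv₀ (by fun_prop) fun s => (Real.sqrt_pos.2 (by positivity)).ne')

/-- Bounds for `1 / A - 1 / B = (B² - A²) / (A B (A + B))`; with `A² = c² / 4 + r²` and `B² = c² + r²`
the numerator is `3 c² / 4`. -/
theorem inv_sub_inv_bounds {A B : ℝ} (hA : 0 < A) (hAB : A ≤ B) :
    (B ^ 2 - A ^ 2) / 2 * B⁻¹ ^ 3 ≤ A⁻¹ - B⁻¹ ∧ A⁻¹ - B⁻¹ ≤ (B ^ 2 - A ^ 2) / 2 * A⁻¹ ^ 3 := by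
  have hB : 0 < B := hA.trans_le hAB
  have hd : 0 ≤ B - A := sub_nonneg.2 hAB
  have h : A⁻¹ - B⁻¹ = (B - A) / (A * B) := by field_simp
  rw [h]
  constructor
  · rw [inv_pow, ← div_eq_mul_inv, div_div, div_le_div_iff₀ (by positivity) (by positivity)]
    have : 0 ≤ (B - A) * B * (2 * B ^ 2 - (A + B) * A) :=
      mul_nonneg (mul_nonneg hd hB.le) (by nlinarith)
    nlinarith
  · rw [inv_pow, ← div_eq_mul_inv, div_div, div_le_div_iff₀ (by positivity) (by positivity)]
    have : 0 ≤ (B - A) * A * ((A + B) * B - 2 * A ^ 2) :=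
      mul_nonneg (mul_nonneg hd hA.le) (by nlinarith)
    nlinarith

theorem le_kernel (hc : 0 < c) (r : ℝ) :
    3 / 8 * c ^ 2 * (√(c ^ 2 + r ^ 2))⁻¹ ^ 3 ≤ kernel c r := by
  have h := (inv_sub_inv_bounds (A := √((c / 2) ^ 2 + r ^ 2)) (B := √(c ^ 2 + r ^ 2))
    (Real.sqrt_pos.2 (by positivity)) (Real.sqrt_le_sqrt (by nlinarith))).1
  rw [Real.sq_sqrt (by positivity), Real.sq_sqrt (by positivity)] at h
  refine le_trans (le_of_eq ?_) h
  ring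

theorem kernel_le_of_le (hc : 0 < c) (hδ : 0 < δ) (hr : δ ≤ r) :
    kernel c r ≤ 3 / 8 * c ^ 2 * δ⁻¹ ^ 3 := by
  have h := (inv_sub_inv_bounds (A := √((c / 2) ^ 2 + r ^ 2)) (B := √(c ^ 2 + r ^ 2))
    (Real.sqrt_pos.2 (by positivity)) (Real.sqrt_le_sqrt (by nlinarith))).2
  rw [Real.sq_sqrt (by positivity), Real.sq_sqrt (by positivity)] at h
  have hle : δ ≤ √((c / 2) ^ 2 + r ^ 2) := Real.le_sqrt_of_sq_le (by nlinarith)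
  have h2 : (√((c / 2) ^ 2 + r ^ 2))⁻¹ ^ 3 ≤ δ⁻¹ ^ 3 :=
    pow_le_pow_left₀ (by positivity) (inv_anti₀ hδ hle) 3
  refine h.trans (le_trans (le_of_eq ?_) (mul_le_mul_of_nonneg_left h2 (by positivity)))
  ring

/-- `|y|⁻³` is not integrable near the origin in dimension at most three. This is where the
restriction `n ≤ 4` enters. -/
theorem exists_lt_lintegral {d : ℕ} (hd1 : 1 ≤ d) (hd3 : d ≤ 3) (hδ : 0 < δ) {N : ℝ≥0∞}
    (hN : N ≠ ∞) : ∃ c : ℝ, 0 < c ∧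
      N < ∫⁻ y in closedBall (0 : E d) δ, ENNReal.ofReal ((√(c ^ 2 + ‖y‖ ^ 2))⁻¹ ^ 3) := by
  by_contra! hcon
  have : Nontrivial (E d) := Module.nontrivial_of_finrank_pos (R := ℝ) (by simp; omega)
  have hlim : Tendsto (fun k : ℕ => ∫⁻ y in closedBall (0 : E d) δ,
      ENNReal.ofReal ((√((1 / ((k : ℝ) + 1)) ^ 2 + ‖y‖ ^ 2))⁻¹ ^ 3)) atTop
      (𝓝 (∫⁻ y in closedBall (0 : E d) δ, ENNReal.ofReal (‖y‖⁻¹ ^ 3))) := by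
    have hne : ∀ᵐ y ∂(volume.restrict (closedBall (0 : E d) δ)), y ≠ 0 :=
      ae_restrict_of_ae (by simp [ae_iff])
    refine lintegral_tendsto_of_tendsto_of_monotone (fun k => by fun_prop) ?_ ?_
    · refine .of_forall fun y k l hkl => ENNReal.ofReal_le_ofReal ?_
      refine pow_le_pow_left₀ (by positivity)
        (inv_anti₀ (Real.sqrt_pos.2 (by positivity)) (Real.sqrt_le_sqrt ?_)) 3
      gcongr
    · filter_upwards [hne] with y hy
      have hy' : 0 < ‖y‖ := norm_pos_iff.2 hy
      refine ENNReal.tendsto_ofReal ?_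
      have h1 : Tendsto (fun k : ℕ => √((1 / ((k : ℝ) + 1)) ^ 2 + ‖y‖ ^ 2)) atTop
          (𝓝 (√(0 ^ 2 + ‖y‖ ^ 2))) :=
        ((tendsto_one_div_add_atTop_nhds_zero_nat.pow 2).add_const _).sqrt
      rw [zero_pow two_ne_zero, zero_add, Real.sqrt_sq hy'.le] at h1
      exact (h1.inv₀ hy'.ne').pow 3
  have hle : ∫⁻ y in closedBall (0 : E d) δ, ENNReal.ofReal (‖y‖⁻¹ ^ 3) ≤ N :=
    le_of_tendsto' hlim fun k => hcon _ (by positivity)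
  have hint : IntegrableOn (fun y : E d => ‖y‖⁻¹ ^ 3) (ball (0 : E d) δ) := by
    refine IntegrableOn.mono_set ?_ ball_subset_closedBall
    refine ⟨by fun_prop, ?_⟩
    rw [hasFiniteIntegral_iff_ofReal (.of_forall fun y => by positivity)]
    exact hle.trans_lt hN.lt_top
  rw [integrableOn_fun_norm_addHaar volume (f := fun s => s⁻¹ ^ 3),
    finrank_euclideanSpace_fin] at hint
  have hrpow : IntegrableOn (fun s : ℝ => s ^ ((d : ℝ) - 4)) (Ioo 0 δ) := by
    refine hint.congr_fun (fun s hs => ?_) measurableSet_Ioo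
    have hs0 : 0 < s := hs.1
    simp only [smul_eq_mul]
    rw [show (d : ℝ) - 4 = ((d - 1 : ℕ) : ℝ) - (3 : ℕ) by rw [Nat.cast_sub hd1]; push_cast; ring,
      Real.rpow_sub hs0, Real.rpow_natCast, Real.rpow_natCast, inv_pow, div_eq_mul_inv]
  rw [intervalIntegral.integrableOn_Ioo_rpow_iff hδ] at hrpow
  have : (d : ℝ) ≤ 3 := by exact_mod_cast hd3
  linarith

/-- The mass of the kernel in the ball of radius `R`. -/
noncomputable def kernelMass (d : ℕ) (c R : ℝ) : ℝ :=
  ∫ y in closedBall (0 : E d) R, kernel c ‖y‖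

theorem integrable_kernel (hc : 0 < c) {V : Type*} [NormedAddCommGroup V] [InnerProductSpace ℝ V]
    [FiniteDimensional ℝ V] [MeasurableSpace V] [BorelSpace V] {s : Set V} (hs : volume s ≠ ∞) :
    IntegrableOn (fun y : V => kernel c ‖y‖) s := by
  have hfin : IsFiniteMeasure (volume.restrict s) := ⟨by simpa using hs.lt_top⟩
  refine Integrable.of_bound
    ((continuous_kernel hc).comp continuous_norm).aestronglyMeasurable (2 / c) (.of_forall fun y => ?_)
  rw [Real.norm_of_nonneg (kernel_nonneg hc _)]
  exact kernel_le hc _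

/-- In dimension at most three the kernel concentrates at the origin. -/
theorem exists_kernelMass_le {d : ℕ} (hd1 : 1 ≤ d) (hd3 : d ≤ 3) (hδ : 0 < δ) (hδR : δ ≤ R)
    {η : ℝ} (hη : 0 < η) :
    ∃ c : ℝ, 0 < c ∧ 0 < kernelMass d c δ ∧
      kernelMass d c R ≤ (1 + η) * kernelMass d c δ := by
  set B := volume.real (closedBall (0 : E d) R) with hB
  have hBnn : 0 ≤ B := measureReal_nonneg
  have hcb : ∀ t : ℝ, volume (closedBall (0 : E d) t) ≠ ∞ := fun t =>
    (isCompact_closedBall _ _).measure_lt_top.ne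
  obtain ⟨c, hc, hN⟩ := exists_lt_lintegral hd1 hd3 hδ
    (N := ENNReal.ofReal (δ⁻¹ ^ 3 * B / η)) ENNReal.ofReal_ne_top
  have hcont : Continuous fun y : E d => (√(c ^ 2 + ‖y‖ ^ 2))⁻¹ ^ 3 :=
    (Continuous.inv₀ (by fun_prop) fun s => (Real.sqrt_pos.2 (by positivity)).ne').pow _
  have hint : IntegrableOn (fun y : E d => (√(c ^ 2 + ‖y‖ ^ 2))⁻¹ ^ 3) (closedBall 0 δ) :=
    hcont.continuousOn.integrableOn_compact (isCompact_closedBall _ _)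
  set I := ∫ y in closedBall (0 : E d) δ, (√(c ^ 2 + ‖y‖ ^ 2))⁻¹ ^ 3 with hI
  have hI1 : δ⁻¹ ^ 3 * B / η < I := by
    rw [hI, integral_eq_lintegral_of_nonneg_ae (.of_forall fun y => by positivity)
      hint.aestronglyMeasurable]
    exact (ENNReal.ofReal_lt_iff_lt_toReal (by positivity) hint.lintegral_lt_top.ne).1 hN
  have hI0 : 0 < I := lt_of_le_of_lt (by positivity) hI1
  have hlow : 3 / 8 * c ^ 2 * I ≤ kernelMass d c δ := by
    rw [hI, kernelMass, ← integral_const_mul]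
    exact integral_mono (hint.const_mul _) (integrable_kernel hc (hcb δ)) fun y => le_kernel hc _
  have hsub : closedBall (0 : E d) δ ⊆ closedBall 0 R := closedBall_subset_closedBall hδR
  have hhigh : kernelMass d c R ≤ kernelMass d c δ + 3 / 8 * c ^ 2 * δ⁻¹ ^ 3 * B := by
    have hsplit : kernelMass d c R = kernelMass d c δ +
        ∫ y in closedBall (0 : E d) R \ closedBall 0 δ, kernel c ‖y‖ := by
      rw [setIntegral_sdiff measurableSet_closedBall (integrable_kernel hc (hcb R)) hsub]
      simp [kernelMass]
    rw [hsplit]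
    gcongr
    have hfin' : volume (closedBall (0 : E d) R \ closedBall 0 δ) < ∞ :=
      (measure_mono sdiff_subset).trans_lt (hcb R).lt_top
    have h1 : ∫ y in closedBall (0 : E d) R \ closedBall 0 δ, kernel c ‖y‖ ≤
        ∫ _ in closedBall (0 : E d) R \ closedBall 0 δ, 3 / 8 * c ^ 2 * δ⁻¹ ^ 3 := by
      refine setIntegral_mono_on (integrable_kernel hc hfin'.ne)
        (integrableOn_const hfin'.ne) (measurableSet_closedBall.diff measurableSet_closedBall)
        fun y hy => kernel_le_of_le hc hδ ?_
      have h2 := hy.2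
      rw [mem_closedBall_zero_iff, not_le] at h2
      exact h2.le
    refine h1.trans ?_
    rw [setIntegral_const, smul_eq_mul, mul_comm]
    exact mul_le_mul_of_nonneg_left (measureReal_mono sdiff_subset (hcb R)) (by positivity)
  refine ⟨c, hc, lt_of_lt_of_le (by positivity) hlow, ?_⟩
  have h3 : δ⁻¹ ^ 3 * B ≤ η * I := by
    rw [div_lt_iff₀ hη] at hI1
    linarith
  have h4 : 3 / 8 * c ^ 2 * (δ⁻¹ ^ 3 * B) ≤ 3 / 8 * c ^ 2 * (η * I) :=
    mul_le_mul_of_nonneg_left h3 (by positivity)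
  have h5 := mul_le_mul_of_nonneg_left hlow hη.le
  linarith

end Kernel

/-! ### Convex bodies in dimensions two to four -/

section Chords

variable {n : ℕ} {K : Set (E n)}

theorem IsSymmetricConvexBody.zero_mem_interior (hK : IsSymmetricConvexBody K) :
    (0 : E n) ∈ interior K := by
  obtain ⟨x, hx⟩ := hK.nonempty_interior
  have hneg : -x ∈ interior K := by
    have h : interior K = -interior K := by
      conv_lhs => rw [← hK.symmetric]
      exact (Homeomorph.neg (E n)).preimage_interior K |>.symm
    rw [h]
    simpa using hx
  have := hK.convex.interior hx hneg (a := 1 / 2) (b := 1 / 2) (by norm_num) (by norm_num)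
    (by norm_num)
  simpa using this

theorem IsSymmetricConvexBody.isRayGauge (hK : IsSymmetricConvexBody K) : IsRayGauge (gauge K) where
  continuous := continuous_gauge hK.convex (mem_interior_iff_mem_nhds.1 hK.zero_mem_interior)
  smul_of_nonneg t x ht := by rw [gauge_smul_of_nonneg ht, smul_eq_mul]
  pos x hx := by
    rwa [gauge_pos (absorbent_nhds_zero (mem_interior_iff_mem_nhds.1 hK.zero_mem_interior))
      ((NormedSpace.isVonNBounded_iff ℝ).2 hK.isCompact.isBounded)]

theorem IsSymmetricConvexBody.gauge_le_one_iff (hK : IsSymmetricConvexBody K) (x : E n) :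
    gauge K x ≤ 1 ↔ x ∈ K := by
  rw [gauge_le_one_iff_mem_closure hK.convex (mem_interior_iff_mem_nhds.1 hK.zero_mem_interior),
    hK.isCompact.isClosed.closure_eq]

theorem IsSymmetricConvexBody.isStarBody (hK : IsSymmetricConvexBody K) : IsStarBody K := by
  have h := hK.isRayGauge.isStarBody hK.symmetric.gauge_neg
  rwa [show {x | gauge K x ≤ 1} = K from ext hK.gauge_le_one_iff] at h

theorem IsSymmetricConvexBody.gauge_add_le (hK : IsSymmetricConvexBody K) (x y : E n) :
    gauge K (x + y) ≤ gauge K x + gauge K y :=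
  _root_.gauge_add_le hK.convex
    (absorbent_nhds_zero (mem_interior_iff_mem_nhds.1 hK.zero_mem_interior)) x y

/-- Among the chords of an origin-symmetric convex body in a given direction, the central one is the
longest. -/
theorem IsSymmetricConvexBody.volume_chord_le (hK : IsSymmetricConvexBody K) {θ : E n}
    (hθ : θ ∈ unitSphere n) (y : E n) :
    volume {t : ℝ | y + t • θ ∈ K} ≤ ENNReal.ofReal (2 * radial K θ) := by
  have hp := hK.isRayGauge.pos_sphere ⟨θ, hθ⟩
  refine (Real.volume_le_diam _).trans (Metric.ediam_le fun s hs t ht => ?_)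
  rw [edist_dist]
  refine ENNReal.ofReal_le_ofReal ?_
  have h1 : gauge K ((s - t) • θ) ≤ 2 := by
    have h2 := hK.gauge_add_le (y + s • θ) (-(y + t • θ))
    rw [hK.symmetric.gauge_neg] at h2
    have h3 := (hK.gauge_le_one_iff _).2 hs
    have h4 := (hK.gauge_le_one_iff _).2 ht
    rw [show y + s • θ + -(y + t • θ) = (s - t) • θ by module] at h2
    linarith
  have habs : gauge K ((s - t) • θ) = |s - t| * gauge K θ := by
    rcases le_total 0 (s - t) with h | h
    · rw [hK.isRayGauge.smul_of_nonneg _ _ h, abs_of_nonneg h]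
    · rw [← hK.symmetric.gauge_neg, ← neg_smul,
        hK.isRayGauge.smul_of_nonneg _ _ (neg_nonneg.2 h), abs_of_nonpos h]
  rw [habs] at h1
  rw [Real.dist_eq, radial, ← div_eq_mul_inv, le_div_iff₀ hp]
  exact h1

/-- Chords through points of small gauge are almost as long as the central one, by the triangle
inequality for the gauge. -/
theorem IsSymmetricConvexBody.le_volume_chord (hK : IsSymmetricConvexBody K) {θ : E n}
    (hθ : θ ∈ unitSphere n) {y : E n} {a : ℝ} (hy : gauge K y ≤ a) :
    ENNReal.ofReal (2 * radial K θ * (1 - a)) ≤ volume {t : ℝ | y + t • θ ∈ K} := by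
  have hp : 0 < gauge K θ := hK.isRayGauge.pos_sphere ⟨θ, hθ⟩
  set m := radial K θ * (1 - a) with hm
  have hsub : Icc (-m) m ⊆ {t : ℝ | y + t • θ ∈ K} := by
    intro t ht
    have ht' : |t| ≤ m := abs_le.2 ht
    refine (hK.gauge_le_one_iff _).1 ?_
    have habs : gauge K (t • θ) = |t| * gauge K θ := by
      rcases le_total 0 t with h | h
      · rw [hK.isRayGauge.smul_of_nonneg _ _ h, abs_of_nonneg h]
      · rw [← hK.symmetric.gauge_neg, ← neg_smul,
          hK.isRayGauge.smul_of_nonneg _ _ (neg_nonneg.2 h), abs_of_nonpos h]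
    have h1 := hK.gauge_add_le y (t • θ)
    have h2 : |t| * gauge K θ ≤ m * gauge K θ := mul_le_mul_of_nonneg_right ht' hp.le
    have h3 : m * gauge K θ = 1 - a := by
      rw [hm, radial, mul_right_comm, inv_mul_cancel₀ hp.ne', one_mul]
    linarith
  refine le_trans (le_of_eq ?_) (measure_mono hsub)
  rw [Real.volume_Icc, hm]
  congr 1
  ring

/-- The integral over `K` of a function of the distance to the axis `ℝ θ`, by chords in direction `θ`. -/
theorem setLIntegral_projection {θ : E n} (hθ : θ ∈ unitSphere n) (hK : MeasurableSet K)
    {u : ℝ → ℝ≥0∞} (hu : Measurable u) :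
    ∫⁻ z in K, u ‖(perp θ).orthogonalProjectionOnto z‖ =
      ∫⁻ y : perp θ, u ‖y‖ * volume {t : ℝ | (y : E n) + t • θ ∈ K} := by
  have hθn : ‖θ‖ = 1 := by simpa using hθ
  rw [← lintegral_indicator hK, lintegral_slice' hθn (by
    refine Measurable.indicator ?_ hK
    fun_prop)]
  refine lintegral_congr fun y => ?_
  have hm : MeasurableSet {t : ℝ | (y : E n) + t • θ ∈ K} :=
    hK.preimage (by fun_prop : Measurable fun t : ℝ => (y : E n) + t • θ)
  rw [← lintegral_indicator_one hm, ← lintegral_const_mul _ (measurable_one.indicator hm)]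
  refine lintegral_congr fun t => ?_
  have h0 : (perp θ).orthogonalProjectionOnto ((y : E n) + t • θ) = y := by
    have h1 : (perp θ).orthogonalProjectionOnto θ = 0 :=
      Submodule.orthogonalProjectionOnto_orthogonalComplement_singleton_eq_zero θ
    rw [map_add, map_smul, h1, smul_zero, add_zero,
      Submodule.orthogonalProjectionOnto_mem_subspace_eq_self]
  by_cases h : (y : E n) + t • θ ∈ K <;> simp [indicator, h, h0]

theorem ofReal_kernelMass {c : ℝ} (hc : 0 < c) {θ : E n} (hθ : θ ∈ unitSphere n) (R : ℝ) :
    ∫⁻ y in closedBall (0 : perp θ) R, ENNReal.ofReal (kernel c ‖y‖) =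
      ENNReal.ofReal (kernelMass (n - 1) c R) := by
  obtain ⟨e⟩ := exists_isometry_perp hθ
  have hk := continuous_kernel hc
  rw [kernelMass, ofReal_integral_eq_lintegral_ofReal
    (integrable_kernel hc (isCompact_closedBall _ _).measure_lt_top.ne)
    (.of_forall fun y => kernel_nonneg hc _), ← lintegral_indicator measurableSet_closedBall,
    ← lintegral_indicator measurableSet_closedBall, ← e.measurePreserving.lintegral_comp
    (Measurable.indicator (by fun_prop) measurableSet_closedBall)]
  refine lintegral_congr fun y => ?_
  simp [indicator]

/-- The integral of the kernel over a convex body, compared with the radial function: the kernel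
sees only chords in direction `θ` that are close to the central one. -/
theorem IsSymmetricConvexBody.kernel_integral_bounds (hK : IsSymmetricConvexBody K) {c r R δ : ℝ}
    (hc : 0 < c) (hr : 0 < r) (hrK : ∀ x, r * gauge K x ≤ ‖x‖) (hR : K ⊆ closedBall 0 R)
    (hδr : δ ≤ r) {θ : E n} (hθ : θ ∈ unitSphere n) :
    2 * radial K θ * (1 - δ / r) * kernelMass (n - 1) c δ ≤
      ∫ z in K, kernel c ‖(perp θ).orthogonalProjectionOnto z‖ ∧
    ∫ z in K, kernel c ‖(perp θ).orthogonalProjectionOnto z‖ ≤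
      2 * radial K θ * kernelMass (n - 1) c R := by
  have hk := continuous_kernel hc
  have hKm := hK.isCompact.isClosed.measurableSet
  have hmass : ∀ t, 0 ≤ kernelMass (n - 1) c t := fun t =>
    integral_nonneg fun y => kernel_nonneg hc _
  have hrad : 0 ≤ radial K θ := inv_nonneg.2 (gauge_nonneg _)
  have hδ1 : 0 ≤ 1 - δ / r := sub_nonneg.2 ((div_le_one hr).2 hδr)
  have hKint : IntegrableOn (fun z => kernel c ‖(perp θ).orthogonalProjectionOnto z‖) K :=
    ContinuousOn.integrableOn_compact hK.isCompact (Continuous.continuousOn (by fun_prop))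
  have heq : ENNReal.ofReal (∫ z in K, kernel c ‖(perp θ).orthogonalProjectionOnto z‖) =
      ∫⁻ y : perp θ, ENNReal.ofReal (kernel c ‖y‖) * volume {t : ℝ | (y : E n) + t • θ ∈ K} := by
    rw [ofReal_integral_eq_lintegral_ofReal hKint (.of_forall fun z => kernel_nonneg hc _)]
    exact setLIntegral_projection hθ hKm (u := fun s => ENNReal.ofReal (kernel c s)) (by fun_prop)
  constructor
  · rw [← ENNReal.ofReal_le_ofReal_iff (integral_nonneg fun z => kernel_nonneg hc _), heq,
      ENNReal.ofReal_mul (by positivity), ← ofReal_kernelMass hc hθ,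
      ← lintegral_const_mul' _ _ ENNReal.ofReal_ne_top]
    refine le_trans (setLIntegral_mono' measurableSet_closedBall fun y hy => ?_)
      (setLIntegral_le_lintegral (closedBall (0 : perp θ) δ) _)
    rw [mul_comm]
    refine mul_le_mul_right (hK.le_volume_chord hθ ?_) _
    rw [le_div_iff₀' hr]
    exact (hrK y).trans (by simpa using hy)
  · rw [← ENNReal.ofReal_le_ofReal_iff (mul_nonneg (by positivity) (hmass R)), heq,
      ENNReal.ofReal_mul (by positivity), ← ofReal_kernelMass hc hθ,
      ← lintegral_const_mul' _ _ ENNReal.ofReal_ne_top, ← lintegral_indicator measurableSet_closedBall]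
    refine lintegral_mono fun y => ?_
    by_cases hy : y ∈ closedBall (0 : perp θ) R
    · rw [indicator_of_mem hy, mul_comm]
      exact mul_le_mul_left (hK.volume_chord_le hθ _) _
    · have hempty : {t : ℝ | (y : E n) + t • θ ∈ K} = ∅ := by
        refine eq_empty_of_forall_notMem fun t ht => hy ?_
        have h1 : ‖(y : E n) + t • θ‖ ≤ R := by simpa using hR ht
        have h2 : ⟪(y : E n), t • θ⟫ = 0 := by
          rw [inner_smul_right, Submodule.mem_orthogonal_singleton_iff_inner_left.1 y.2, mul_zero]
        have h3 := norm_add_sq_eq_norm_sq_add_norm_sq_of_inner_eq_zero _ _ h2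
        rw [mem_closedBall_zero_iff]
        refine le_trans (le_of_sq_le_sq ?_ (norm_nonneg _)) h1
        rw [Submodule.coe_norm]
        nlinarith [norm_nonneg (t • θ)]
      rw [hempty, measure_empty, mul_zero]
      exact zero_le

/-- In dimensions two to four every origin-symmetric convex body is an intersection body. -/
theorem IsSymmetricConvexBody.isIntersectionBody (hn : 2 ≤ n) (hn4 : n ≤ 4)
    (hK : IsSymmetricConvexBody K) : IsIntersectionBody K := by
  refine ⟨hK.isStarBody, hK.symmetric, fun ε hε => ?_⟩
  have hκ := vol_closedBall_pos (n - 1)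
  obtain ⟨r, hr, hrK⟩ : ∃ r : ℝ, 0 < r ∧ ∀ x, r * gauge K x ≤ ‖x‖ := by
    obtain ⟨r, hr, hball⟩ := Metric.mem_nhds_iff.1 (mem_interior_iff_mem_nhds.1 hK.zero_mem_interior)
    exact ⟨r, hr, fun x => mul_gauge_le_norm hball⟩
  obtain ⟨R, hR0, hR⟩ := hK.isRayGauge.exists_subset_closedBall
  have hRK : K ⊆ closedBall 0 R := fun x hx => hR ((hK.gauge_le_one_iff x).2 hx)
  have hradR : ∀ θ ∈ unitSphere n, 0 < radial K θ ∧ radial K θ ≤ R := by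
    intro θ hθ
    have hp : 0 < gauge K θ := hK.isRayGauge.pos_sphere ⟨θ, hθ⟩
    have h0 : 0 < radial K θ := inv_pos.2 hp
    refine ⟨h0, ?_⟩
    have h1 : radial K θ • θ ∈ {x | gauge K x ≤ 1} := by
      rw [mem_ofPred_eq, hK.isRayGauge.smul_of_nonneg _ _ h0.le, radial, inv_mul_cancel₀ hp.ne']
    have h2 := hR h1
    rwa [mem_closedBall_zero_iff, norm_smul, Real.norm_of_nonneg h0.le,
      show ‖θ‖ = 1 by simpa using hθ, mul_one] at h2
  -- chords at distance at most `δ` from the central one have at least `1 - a` times its length, and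
  -- the kernel mass outside the ball of radius `δ` is at most `a` times the mass inside; as
  -- `ρ_K ≤ R`, the two errors add up to at most `2 a R ≤ ε / 2`
  set a := min (1 / 2) (ε / (4 * R)) with ha
  have ha0 : 0 < a := lt_min (by norm_num) (by positivity)
  have haR : a * R ≤ ε / 4 := by
    calc a * R ≤ ε / (4 * R) * R := mul_le_mul_of_nonneg_right (min_le_right _ _) hR0.le
      _ = ε / 4 := by field_simp
  have ha1 : a ≤ 1 / 2 := min_le_left _ _
  set δ := min (r * a) R with hδ
  have hδ0 : 0 < δ := lt_min (by positivity) hR0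
  have hδa : δ / r ≤ a := by
    rw [div_le_iff₀ hr, mul_comm]
    exact min_le_left _ _
  have hδr : δ ≤ r := (min_le_left _ _).trans (by nlinarith)
  obtain ⟨c, hc, hJδ, hJR⟩ := exists_kernelMass_le (d := n - 1) (by omega) (by omega) hδ0
    (min_le_right _ _ : δ ≤ R) ha0
  set Jδ := kernelMass (n - 1) c δ
  set JR := kernelMass (n - 1) c R
  have hJR0 : 0 < JR := by
    refine hJδ.trans_le (setIntegral_mono_set (integrable_kernel hc
      (isCompact_closedBall _ _).measure_lt_top.ne) (.of_forall fun y => kernel_nonneg hc _) ?_)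
    exact (closedBall_subset_closedBall (min_le_right _ _)).eventuallyLE
  set κ := vol (closedBall (0 : E (n - 1)) 1)
  set α := (κ * c⁻¹ ^ (n - 1) * c * (2 * JR))⁻¹ with hα
  have hα0 : 0 < α := by positivity
  set η := ε / (2 * κ) with hη
  have hη0 : 0 < η := by positivity
  have hcont := continuous_density (n := n) hc hK.isCompact
  obtain ⟨K', L', hKL, hrad⟩ := exists_isIntersectionBodyOf hn
    (G := fun ξ => α * density K c ξ + η) (by fun_prop)
    (fun ξ hξ => add_pos_of_nonneg_of_pos
      (mul_nonneg hα0.le (density_nonneg hc hK.convex hK.isCompact hK.symmetric hξ)) hη0)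
    (fun ξ _ => by simp only [density_neg])
  refine ⟨K', L', hKL, fun θ hθ => ?_⟩
  have hfr := finrank_perp hθ
  have hd : (0 : ℝ) < (n - 1 : ℕ) := by exact_mod_cast (by omega : 0 < n - 1)
  have : Nontrivial (perp θ) := Module.nontrivial_of_finrank_pos (R := ℝ) (by omega)
  have hsphere : (∫ _ : sphere (0 : perp θ) 1, η ∂(volume : Measure (perp θ)).toSphere) /
      (n - 1 : ℕ) = ε / 2 := by
    rw [integral_const, Measure.toSphere_real_apply_univ, hfr, measureReal_def,
      ← Measure.addHaar_closedBall_eq_addHaar_ball, volume_closedBall_perp hθ, ← measureReal_def,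
      smul_eq_mul]
    change (n - 1 : ℕ) * κ * η / (n - 1 : ℕ) = ε / 2
    rw [hη]
    field_simp
  have hint : Integrable (fun v : sphere (0 : perp θ) 1 => density K c ((v : perp θ) : E n))
      (volume : Measure (perp θ)).toSphere :=
    Continuous.integrable_of_hasCompactSupport (by fun_prop) (.of_compactSpace _)
  have hval : radial K' θ = (∫ z in K, kernel c ‖(perp θ).orthogonalProjectionOnto z‖) / (2 * JR)
      + ε / 2 := by
    rw [hrad θ hθ, integral_add (hint.const_mul _) (integrable_const _), integral_const_mul,
      add_div, hsphere, mul_div_assoc, integral_density hn hc hK.isCompact hθ, hα]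
    congr 1
    change _ * (κ * c⁻¹ ^ (n - 1) * c * _) = _
    field_simp
  obtain ⟨hlow, hhigh⟩ := hK.kernel_integral_bounds hc hr hrK hRK hδr hθ
  obtain ⟨hρ0, hρR⟩ := hradR θ hθ
  set S := ∫ z in K, kernel c ‖(perp θ).orthogonalProjectionOnto z‖
  set ρ := radial K θ
  have h1 : S / (2 * JR) ≤ ρ := by
    rw [div_le_iff₀ (by positivity)]
    linarith
  have h2 : ρ - 2 * (a * R) ≤ S / (2 * JR) := by
    rw [le_div_iff₀ (by positivity)]
    refine le_trans ?_ hlow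
    change _ ≤ 2 * ρ * (1 - δ / r) * Jδ
    -- `(1 - a) Jδ ≥ (1 - a) JR / (1 + a) ≥ (1 - 2 a) JR`
    have h3 : (1 - 2 * a) * JR ≤ (1 - a) * Jδ := by
      calc (1 - 2 * a) * JR ≤ (1 - 2 * a) * ((1 + a) * Jδ) :=
            mul_le_mul_of_nonneg_left hJR (by linarith)
        _ ≤ (1 - a) * Jδ := by nlinarith [mul_pos ha0 hJδ, mul_pos (mul_pos ha0 ha0) hJδ]
    have h4 : (1 - a) * Jδ ≤ (1 - δ / r) * Jδ := mul_le_mul_of_nonneg_right (by linarith) hJδ.le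
    have h5 : ρ * ((1 - 2 * a) * JR) ≤ ρ * ((1 - δ / r) * Jδ) :=
      mul_le_mul_of_nonneg_left (h3.trans h4) hρ0.le
    have h6 : ρ * (a * JR) ≤ R * (a * JR) := mul_le_mul_of_nonneg_right hρR (by positivity)
    linarith
  rw [hval, abs_le]
  constructor <;> linarith

end Chords

end SectionStability

theorem corollary1 (n : ℕ) (hn : 1 ≤ n) :
    -- the volume difference inequality, the maximum being attained
    (∀ K L : Set (SectionStability.E n),
      SectionStability.IsIntersectionBody K → SectionStability.IsIntersectionBody L →
      ∃ M : ℝ,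
        IsGreatest ((fun ξ => |SectionStability.sectionVol K ξ - SectionStability.sectionVol L ξ|) ''
          SectionStability.unitSphere n) M ∧
        |SectionStability.vol K ^ (((n : ℝ) - 1) / n) - SectionStability.vol L ^ (((n : ℝ) - 1) / n)|
          ≤ SectionStability.sectionConst n * M) ∧
    -- the hyperplane inequality
    (∀ K : Set (SectionStability.E n), SectionStability.IsIntersectionBody K →
      ∃ M : ℝ,
        IsGreatest ((fun ξ => SectionStability.sectionVol K ξ) '' SectionStability.unitSphere n) M ∧
        SectionStability.vol K ^ (((n : ℝ) - 1) / n) ≤ SectionStability.sectionConst n * M) ∧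
    -- in dimensions 3 and 4 both apply to all origin-symmetric convex bodies
    (n = 3 ∨ n = 4 → ∀ K : Set (SectionStability.E n),
      SectionStability.IsSymmetricConvexBody K → SectionStability.IsIntersectionBody K) :=
  ⟨fun _ _ hK hL => SectionStability.volume_difference_inequality hn hK hL,
    fun _ hK => SectionStability.hyperplane_inequality hn hK,
    fun h _ hK => hK.isIntersectionBody (by omega) (by omega)⟩
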